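/- **Setting.** A CNF formula is a conjunction of clauses, and a clause is a disjunction of a set of literals. Write $\varphi\vdash_1 C$ if $C$ is derivable from $\varphi$ by unit resolution (from a clause $C$ and a unit clause $\neg l$, where $l\in C$, derive $C\setminus\{l\}$). A CNF formula $\varphi(\mathbf x,\mathbf y)$ is an *encoding* of a Boolean function $f(\mathbf x)$ if $f(\mathbf a)=\exists \mathbf b\,\varphi(\mathbf a,\mathbf b)$ for all $\mathbf a$. It is a *URC encoding* if moreover for every partial assignment $\alpha$ (a set of literals without a complementary pair) of $\mathbf x\cup\mathbf y$, $\varphi\wedge\alpha\models\bot$ implies $\varphi\wedge\alpha\vdash_1\bot$. It is a *PC encoding* if moreover for every such $\alpha$ and every literal $l$ on $\mathbf x\cup\mathbf y$, $\varphi\wedge\alpha\models l$ implies $\varphi\wedge\alpha\vdash_1 l$ or $\varphi\wedge\alpha\vdash_1\bot$. Let $x_1,\dots,x_n$ be Boolean variables. Let $D$ be a finite rooted DAG (every node is reachable from the root $\rho$) whose inner nodes are labelled $\wedge$ or $\vee$ and whose leaves are labelled with pairwise different domain variables $[x_i=s]$, $s\in\{0,1\}$, such that for each $i$ at least one of $[x_i=0],[x_i=1]$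 occurs. Let $\mathrm{var}(v)$ be the set of the $x_i$ such that a leaf labelled $[x_i=0]$ or $[x_i=1]$ is reachable from $v$. Assume that $D$ is a smooth DNNF: the inputs $u$ of each $\wedge$-node have pairwise disjoint sets $\mathrm{var}(u)$ (decomposability), and every input $u$ of each $\vee$-node $v$ has $\mathrm{var}(u)=\mathrm{var}(v)$ (smoothness). Let $D$ represent $f(x_1,\dots,x_n)$, i.e. $f(\mathbf b)=1$ iff $\rho$ evaluates to $1$ when each leaf $[x_i=s]$ has the truth value of $b_i=s$. Let $H_i=\{v : x_i\in\mathrm{var}(v)\}$, let $D_i$ be the subgraph of $D$ induced on $H_i$, and let $L_i$ be the set of the leaves in $H_i$. A set $S\subseteq H_i$ is a *separator* in $D_i$ if every path in $D_i$ from $\rho$ to a leaf contains exactly one node of $S$. Assume that for each $i$ a collection $\mathcal S_i$ of separators in $D_i$ with $\bigcup\mathcal S_i=H_i\setminus\{\rho\}$ is given, and let $\mathcal S=\bigcup_i\mathcal S_i$. Use the nodes of $D$ as Boolean variables, a leaf being identified with the domain variable labelling it. Consider the following clauses: - (N1) $v\to v_1\vee\dots\vee v_k$ for each $v=v_1\vee\dots\vee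 v_k$; - (N2) $v\to v_j$ for each $v=v_1\wedge\dots\wedge v_k$ and $j=1,\dots,k$; - (N3) $v\to p_1\vee\dots\vee p_k$ for each node $v$ with incoming edges from exactly $p_1,\dots,p_k$, $k\ge1$; - (N4) $\neg [x_i=s]$ for each domain variable $[x_i=s]$ that is not a leaf of $D$; - the unit clause $\rho$. Let $\psi_c$ consist of these clauses and, for all $S\in\mathcal S$, the clauses $\neg u\vee\neg v$ for distinct $u,v\in S$. Let $\psi_p$ be $\psi_c$ together with the clauses $\bigvee_{v\in S}v$ for all $S\in\mathcal S$. Let $\psi'_c$ (respectively $\psi'_p$) consist of the clauses N1--N4, $\rho$, and, for each $S\in\mathcal S$, a formula $\theta_S$ on the variables $S\cup\mathbf z_S$, where the auxiliary variables $\mathbf z_S$ are new and disjoint for different $S$. The formula $\theta_S$ is $\mu_{|S|}$ (respectively $\varepsilon_{|S|}$), applied to the elements of $S$ in any order. These are defined as follows. - $\mu_1$ is the empty formula, $\mu_2(x_1,x_2)=\neg x_1\vee\neg x_2$, and $\mu_3(x_1,x_2,x_3)=(\neg x_1\vee\neg x_2)(\neg x_1\vee\neg x_3)(\neg x_2\vee\neg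 x_3)$. For $m\ge4$, $\mu_m(x_1,\dots,x_m)=(\neg x_1\vee\neg x_2)(\neg x_1\vee y)(\neg x_2\vee y)\wedge\mu_{m-1}(y,x_3,\dots,x_m)$ with a new variable $y$. - $\varepsilon_1(x_1)=x_1$, $\varepsilon_2(x_1,x_2)=(\neg x_1\vee\neg x_2)(x_1\vee x_2)$, and $\varepsilon_3(x_1,x_2,x_3)=\mu_3(x_1,x_2,x_3)\wedge(x_1\vee x_2\vee x_3)$. For $m\ge4$, $\varepsilon_m(x_1,\dots,x_m)=\varepsilon_3(x_1,x_2,\neg y_1)\wedge\varepsilon_3(y_1,x_3,\neg y_2)\wedge\dots\wedge\varepsilon_3(y_{m-3},x_{m-1},x_m)$ with new variables $y_1,\dots,y_{m-3}$. More generally, $\psi'_c$ may instead be built with any PC encodings $\theta_S$ of the at-most-one constraint on $S$ that contain no positive literal on $S$. Likewise, $\psi'_p$ may be built with any PC encodings $\theta_S$ of the exactly-one constraint on $S$ such that for each literal $l$ on $\mathbf z_S$ there is a partial assignment $h(l)$ of $S$ with $\theta_S\models(l\Leftrightarrow h(l))$. **Theorem.** Let $\phi_c,\phi'_c,\phi_p,\phi'_p$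 be obtained from $\psi_c,\psi'_c,\psi_p,\psi'_p$, respectively, by the substitutions $[x_i=1]\leftarrow x_i$ and $[x_i=0]\leftarrow\neg x_i$, $i=1,\dots,n$. Then $\phi_c$ and $\phi'_c$ are URC encodings of $f(\mathbf x)$, and $\phi_p$ and $\phi'_p$ are PC encodings of $f(\mathbf x)$ (for the choices $\mu_{|S|}$, $\varepsilon_{|S|}$ and for all the more general choices above). -/

import Mathlib

namespace DNNFEnc

/-! ### Literals, clauses, CNF formulas, unit resolution -/

/-- A literal on a variable of type `W`: the variable if `sign = true`, its negation otherwise. -/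
structure Lit (W : Type*) where
  var : W
  sign : Bool

namespace Lit

/-- The positive literal `w`. -/
def pos {W : Type*} (w : W) : Lit W := ⟨w, true⟩

/-- The negative literal `¬w`. -/
def neg {W : Type*} (w : W) : Lit W := ⟨w, false⟩

/-- The complementary literal. -/
def compl {W : Type*} (l : Lit W) : Lit W := ⟨l.var, !l.sign⟩

/-- The literal `l` is satisfied by the total assignment `a`. -/
def Holds {W : Type*} (a : W → Bool) (l : Lit W) : Prop := a l.var = l.sign

end Lit

/-- A clause is the disjunction of a set of literals. (All variable types used below are finite,
so clauses and formulas are finite sets.) -/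
abbrev Clause (W : Type*) := Set (Lit W)

/-- A CNF formula is the conjunction of a set of clauses. -/
abbrev CNF (W : Type*) := Set (Clause W)

namespace CNF

/-- The total assignment `a` satisfies `φ`. -/
def Sat {W : Type*} (φ : CNF W) (a : W → Bool) : Prop :=
  ∀ C ∈ φ, ∃ l ∈ C, Lit.Holds a l

/-- The formula `φ ∧ α`, where `α` is a set of literals viewed as a conjunction. -/
def andLits {W : Type*} (φ : CNF W) (α : Set (Lit W)) : CNF W :=
  φ ∪ {C | ∃ l ∈ α, C = {l}}

/-- `φ ⊨ ⊥`. -/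
def EntailsFalse {W : Type*} (φ : CNF W) : Prop := ∀ a : W → Bool, ¬ Sat φ a

/-- `φ ⊨ l`. -/
def Entails {W : Type*} (φ : CNF W) (l : Lit W) : Prop :=
  ∀ a : W → Bool, Sat φ a → Lit.Holds a l

/-- `UnitDerives φ C` is `φ ⊢₁ C`: the clause `C` is derivable from `φ` by a series of unit
resolutions, each deriving `C \ {l}` from a clause `C` and the unit clause `¬l`. -/
inductive UnitDerives {W : Type*} (φ : CNF W) : Clause W → Prop
  | ofMem {C : Clause W} (h : C ∈ φ) : UnitDerives φ C
  | resolve {C : Clause W} {l : Lit W} (hC : UnitDerives φ C) (hl : l ∈ C)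
      (hu : UnitDerives φ {l.compl}) : UnitDerives φ (C \ {l})

/-- The formula obtained by replacing every literal `l` by the literal `σ l`. -/
def mapLit {W W' : Type*} (σ : Lit W → Lit W') (φ : CNF W) : CNF W' :=
  (fun C : Clause W => σ '' C) '' φ

/-- The formula obtained by replacing every variable `w` by the variable `g w`. -/
def rename {W W' : Type*} (g : W → W') (φ : CNF W) : CNF W' :=
  mapLit (fun l => ⟨g l.var, l.sign⟩) φ

/-- `φ` is unit refutation complete on the variables in `v`. -/
def URCOn {W : Type*} (φ : CNF W) (v : Set W) : Prop :=
  ∀ α : Set (Lit W), (∀ l ∈ α, l.var ∈ v) → (∀ l ∈ α, l.compl ∉ α) →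
    EntailsFalse (andLits φ α) → UnitDerives (andLits φ α) ∅

/-- `φ` is propagation complete on the variables in `v`. -/
def PCOn {W : Type*} (φ : CNF W) (v : Set W) : Prop :=
  ∀ α : Set (Lit W), (∀ l ∈ α, l.var ∈ v) → (∀ l ∈ α, l.compl ∉ α) →
    ∀ l : Lit W, l.var ∈ v → Entails (andLits φ α) l →
      UnitDerives (andLits φ α) {l} ∨ UnitDerives (andLits φ α) ∅

/-- `φ`, with input variables `X` and auxiliary variables `Y`, is a CNF encoding of the boolean
function `f` (given as a predicate on total assignments). -/
def IsEncoding {X Y : Type*} (f : (X → Bool) → Prop) (φ : CNF (X ⊕ Y)) : Prop :=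
  ∀ a : X → Bool, f a ↔ ∃ b : Y → Bool, Sat φ (Sum.elim a b)

/-- `φ` is a URC encoding of `f`. -/
def IsURCEncoding {X Y : Type*} (f : (X → Bool) → Prop) (φ : CNF (X ⊕ Y)) : Prop :=
  IsEncoding f φ ∧ URCOn φ Set.univ

/-- `φ` is a PC encoding of `f`. -/
def IsPCEncoding {X Y : Type*} (f : (X → Bool) → Prop) (φ : CNF (X ⊕ Y)) : Prop :=
  IsEncoding f φ ∧ PCOn φ Set.univ

end CNF

/-! ### At-most-one and exactly-one constraints -/

/-- The at-most-one constraint on the variables `X`. -/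
def AtMostOne {X : Type*} (a : X → Bool) : Prop :=
  ∀ u v : X, a u = true → a v = true → u = v

/-- The exactly-one constraint on the variables `X`. -/
def ExactlyOne {X : Type*} (a : X → Bool) : Prop := ∃! u : X, a u = true

/-- The canonical representation of the at-most-one constraint on the variables `ν v`, `v ∈ S`,
by its prime implicates `¬u ∨ ¬v`. -/
def amoRep {V W : Type*} (ν : V → W) (S : Finset V) : CNF W :=
  {C | ∃ u ∈ S, ∃ v ∈ S, u ≠ v ∧ C = {Lit.neg (ν u), Lit.neg (ν v)}}

/-- The representation of the exactly-one constraint on the variables `ν v`, `v ∈ S`, by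
`amoRep` and the clause containing all these variables. -/
def eoRep {V W : Type*} (ν : V → W) (S : Finset V) : CNF W :=
  amoRep ν S ∪ {{l | ∃ u ∈ S, l = Lit.pos (ν u)}}

/-- The sequential (ladder) encoding `μ_n` of at-most-one, with `n - 3` auxiliary variables. -/
def mu {W : Type*} : (n : ℕ) → (Fin n → Lit W) → (Fin (n - 3) → W) → CNF W
  | 0, _, _ => ∅
  | 1, _, _ => ∅
  | 2, x, _ => {{(x 0).compl, (x 1).compl}}
  | 3, x, _ => {{(x 0).compl, (x 1).compl}, {(x 0).compl, (x 2).compl},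
      {(x 1).compl, (x 2).compl}}
  | n + 4, x, y =>
      {{(x 0).compl, (x 1).compl}, {(x 0).compl, Lit.pos (y (0 : Fin (n + 1)))},
        {(x 1).compl, Lit.pos (y (0 : Fin (n + 1)))}} ∪
      mu (n + 3)
        (Fin.cons (Lit.pos (y (0 : Fin (n + 1)))) fun k : Fin (n + 2) => x k.succ.succ)
        (fun k : Fin n => y k.succ)

/-- The formula `ε_3` representing exactly-one of three literals. -/
def eps3 {W : Type*} (a b c : Lit W) : CNF W :=
  {{a.compl, b.compl}, {a.compl, c.compl}, {b.compl, c.compl}, {a, b, c}}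

/-- The encoding `ε_n` of exactly-one, with `n - 3` auxiliary variables:
`ε_3(x₁, x₂, ¬y₁) ∧ ε_3(y₁, x₃, ¬y₂) ∧ … ∧ ε_3(y_{n-3}, x_{n-1}, x_n)` for `n ≥ 4`. -/
def eps {W : Type*} : (n : ℕ) → (Fin n → Lit W) → (Fin (n - 3) → W) → CNF W
  | 0, _, _ => {∅}
  | 1, x, _ => {{x 0}}
  | 2, x, _ => {{(x 0).compl, (x 1).compl}, {x 0, x 1}}
  | 3, x, _ => eps3 (x 0) (x 1) (x 2)
  | n + 4, x, y =>
      eps3 (x 0) (x 1) (Lit.neg (y (0 : Fin (n + 1)))) ∪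
      eps (n + 3)
        (Fin.cons (Lit.pos (y (0 : Fin (n + 1)))) fun k : Fin (n + 2) => x k.succ.succ)
        (fun k : Fin n => y k.succ)

/-- The requirements on an at-most-one encoding `θ(x, z)`: it is a PC encoding, and no clause
contains a positive literal on an input variable. -/
def AmoAdmissible {X Z : Type*} (θ : CNF (X ⊕ Z)) : Prop :=
  CNF.IsPCEncoding AtMostOne θ ∧ ∀ C ∈ θ, ∀ x : X, Lit.pos (Sum.inl x) ∉ C

/-- The requirements on an exactly-one encoding `θ(x, z)`: it is a PC encoding, and for each
literal `l` on an auxiliary variable there is a partial assignment `h` of the input variables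
such that `θ ⊨ (l ⇔ h)`. -/
def EoAdmissible {X Z : Type*} (θ : CNF (X ⊕ Z)) : Prop :=
  CNF.IsPCEncoding ExactlyOne θ ∧
    ∀ (z : Z) (s : Bool), ∃ h : Set (Lit X), (∀ g ∈ h, g.compl ∉ h) ∧
      ∀ a : X ⊕ Z → Bool, CNF.Sat θ a →
        (Lit.Holds a ⟨Sum.inr z, s⟩ ↔ ∀ g ∈ h, Lit.Holds (fun x => a (Sum.inl x)) g)

/-! ### NNFs over the direct encoding of finite domains -/

/-- The domain variables `[x_i = s]`, `s ∈ dom(x_i)`. -/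
abbrev DomVar {ι : Type*} (dom : ι → Type*) := Σ i, dom i

/-- Node labels: a connective or a domain variable. -/
inductive NodeLabel {ι : Type*} (dom : ι → Type*)
  | conj
  | disj
  | leaf (d : DomVar dom)

/-- A sentence in negation normal form (with no constants in the leaves): a rooted DAG on the
nodes `V`, whose leaves are labeled with pairwise different domain variables, so that for each `i`
some domain variable of `x_i` occurs. `edge v u` means that `u` is an input of `v`. -/
structure NNF {ι : Type*} (dom : ι → Type*) (V : Type*) where
  edge : V → V → Prop
  root : V
  label : V → NodeLabel dom
  acyclic : ∀ v, ¬ Relation.TransGen edge v v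
  reachable : ∀ v, Relation.ReflTransGen edge root v
  leaf_iff : ∀ v, (∃ d, label v = NodeLabel.leaf d) ↔ ∀ u, ¬ edge v u
  leaf_unique : ∀ u v d, label u = NodeLabel.leaf d → label v = NodeLabel.leaf d → u = v
  occurs : ∀ i, ∃ v s, label v = NodeLabel.leaf ⟨i, s⟩

namespace NNF

/-- The node evaluates to `1` when exactly the domain variables in `a` have value `1`. -/
inductive Eval {ι : Type*} {dom : ι → Type*} {V : Type*} (D : NNF dom V)
    (a : DomVar dom → Prop) : V → Prop
  | leaf {v : V} {d : DomVar dom} (hv : D.label v = NodeLabel.leaf d) (h : a d) : Eval D a v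
  | conj {v : V} (hv : D.label v = NodeLabel.conj) (h : ∀ u, D.edge v u → Eval D a u) :
      Eval D a v
  | disj {v u : V} (hv : D.label v = NodeLabel.disj) (hu : D.edge v u) (h : Eval D a u) :
      Eval D a v

/-- `D` represents the constraint `f`, each `[x_i = s]` being interpreted as `x_i = s`. -/
def Represents {ι : Type*} {dom : ι → Type*} {V : Type*} (D : NNF dom V)
    (f : (∀ i, dom i) → Prop) : Prop :=
  ∀ b : ∀ i, dom i, f b ↔ D.Eval (fun d => b d.1 = d.2) D.root

/-- `var(v)`: the (indices of) variables that appear in the leaves reachable from `v`. -/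
def vars {ι : Type*} {dom : ι → Type*} {V : Type*} (D : NNF dom V) (v : V) : Set ι :=
  {i | ∃ u s, Relation.ReflTransGen D.edge v u ∧ D.label u = NodeLabel.leaf ⟨i, s⟩}

/-- Decomposability: the inputs of a conjunction have pairwise disjoint sets of variables. -/
def Decomposable {ι : Type*} {dom : ι → Type*} {V : Type*} (D : NNF dom V) : Prop :=
  ∀ v, D.label v = NodeLabel.conj →
    ∀ u w, D.edge v u → D.edge v w → u ≠ w → Disjoint (D.vars u) (D.vars w)

/-- Smoothness: all inputs of a disjunction have the same variables as the disjunction. -/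
def Smooth {ι : Type*} {dom : ι → Type*} {V : Type*} (D : NNF dom V) : Prop :=
  ∀ v, D.label v = NodeLabel.disj → ∀ u, D.edge v u → D.vars u = D.vars v

/-- `H_i`, the set of the nodes `v` with `x_i ∈ var(v)`. The graph `D_i` is induced on `H_i`. -/
def H {ι : Type*} {dom : ι → Type*} {V : Type*} (D : NNF dom V) (i : ι) : Set V :=
  {v | i ∈ D.vars v}

/-- The list `p` of nodes is a directed path in `D_i` from the root to a leaf. -/
def IsRootLeafPath {ι : Type*} {dom : ι → Type*} {V : Type*} (D : NNF dom V) (i : ι)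
    (p : List V) : Prop :=
  p.IsChain D.edge ∧ (∀ v ∈ p, v ∈ D.H i) ∧ p.head? = some D.root ∧
    ∃ v d, p.getLast? = some v ∧ D.label v = NodeLabel.leaf d

/-- `S` is a separator in `D_i`. -/
def IsSeparator {ι : Type*} {dom : ι → Type*} {V : Type*} (D : NNF dom V) (i : ι)
    (S : Finset V) : Prop :=
  (∀ v ∈ S, v ∈ D.H i) ∧ ∀ p : List V, D.IsRootLeafPath i p → ∃! v, v ∈ p ∧ v ∈ S

/-- `𝒮 i`, for each `i`, is a collection of separators in `D_i` whose union is `H_i ∖ {root}`. -/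
def IsSeparatorCover {ι : Type*} {dom : ι → Type*} {V : Type*} (D : NNF dom V)
    (𝒮 : ι → Set (Finset V)) : Prop :=
  ∀ i, (∀ S ∈ 𝒮 i, D.IsSeparator i S) ∧
    {v | ∃ S ∈ 𝒮 i, v ∈ S} = D.H i \ {D.root}

/-! ### The encodings -/

/-- The inner nodes of `D`. -/
abbrev Inner {ι : Type*} {dom : ι → Type*} {V : Type*} (D : NNF dom V) :=
  {v : V // ∀ d, D.label v ≠ NodeLabel.leaf d}

open Classical in
/-- The boolean variable of a node: a leaf is identified with the domain variable labeling it,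
an inner node is a variable of its own. -/
noncomputable def nodeVar {ι : Type*} {dom : ι → Type*} {V : Type*} (D : NNF dom V) (v : V) :
    DomVar dom ⊕ D.Inner :=
  if h : ∃ d, D.label v = NodeLabel.leaf d then Sum.inl h.choose
  else Sum.inr ⟨v, fun d hd => h ⟨d, hd⟩⟩

/-- The clauses of groups N1 to N4 and the unit clause on the root, where `ν v` is the boolean
variable of the node `v`, and `δ d` is the boolean variable of the domain variable `d`. -/
def baseClauses {ι : Type*} {dom : ι → Type*} {V W : Type*} (D : NNF dom V)
    (ν : V → W) (δ : DomVar dom → W) : CNF W :=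
  -- N1: `v → v₁ ∨ … ∨ v_k` for `v = v₁ ∨ … ∨ v_k`
  {C | ∃ v, D.label v = NodeLabel.disj ∧
    C = {l | l = Lit.neg (ν v) ∨ ∃ u, D.edge v u ∧ l = Lit.pos (ν u)}} ∪
  -- N2: `v → v_i` for `v = v₁ ∧ … ∧ v_k`
  {C | ∃ v u, D.label v = NodeLabel.conj ∧ D.edge v u ∧
    C = {Lit.neg (ν v), Lit.pos (ν u)}} ∪
  -- N3: `v → p₁ ∨ … ∨ p_k` if `v` has incoming edges from `p₁, …, p_k`
  {C | ∃ v, (∃ p, D.edge p v) ∧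
    C = {l | l = Lit.neg (ν v) ∨ ∃ p, D.edge p v ∧ l = Lit.pos (ν p)}} ∪
  -- N4: `¬d` for each domain variable `d` that labels no leaf
  {C | ∃ d, (∀ v, D.label v ≠ NodeLabel.leaf d) ∧ C = {Lit.neg (δ d)}} ∪
  {{Lit.pos (ν D.root)}}

/-- The separators in the union of the collections `𝒮 i`, each taken once. -/
abbrev Sep {ι V : Type*} (𝒮 : ι → Set (Finset V)) := {S : Finset V // ∃ i, S ∈ 𝒮 i}

/-- The formula `ψ_c`. -/
noncomputable def psiC {ι : Type*} {dom : ι → Type*} {V : Type*} (D : NNF dom V)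
    (𝒮 : ι → Set (Finset V)) : CNF (DomVar dom ⊕ D.Inner) :=
  D.baseClauses D.nodeVar Sum.inl ∪ ⋃ S : Sep 𝒮, amoRep D.nodeVar S.1

/-- The formula `ψ_p`. -/
noncomputable def psiP {ι : Type*} {dom : ι → Type*} {V : Type*} (D : NNF dom V)
    (𝒮 : ι → Set (Finset V)) : CNF (DomVar dom ⊕ D.Inner) :=
  D.baseClauses D.nodeVar Sum.inl ∪ ⋃ S : Sep 𝒮, eoRep D.nodeVar S.1

/-- The variable of a node among the variables of the encodings with auxiliary variables `Z S`
for each separator `S`. -/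
noncomputable def nodeVar' {ι : Type*} {dom : ι → Type*} {V : Type*} (D : NNF dom V)
    {𝒮 : ι → Set (Finset V)} (Z : Sep 𝒮 → Type*) (v : V) :
    DomVar dom ⊕ (D.Inner ⊕ (Σ S, Z S)) :=
  Sum.map id Sum.inl (D.nodeVar v)

/-- The clauses of groups N1 to N4, the unit clause on the root, and for each separator `S` the
formula `θ S` on the nodes of `S` and the auxiliary variables `Z S`. This is `ψ'_c` if the `θ S`
are encodings of at-most-one, and `ψ'_p` if they are encodings of exactly-one. -/
noncomputable def psiPrime {ι : Type*} {dom : ι → Type*} {V : Type*} (D : NNF dom V)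
    {𝒮 : ι → Set (Finset V)} (Z : Sep 𝒮 → Type*) (θ : ∀ S : Sep 𝒮, CNF (S.1 ⊕ Z S)) :
    CNF (DomVar dom ⊕ (D.Inner ⊕ (Σ S, Z S))) :=
  D.baseClauses (D.nodeVar' Z) Sum.inl ∪
    ⋃ S : Sep 𝒮, CNF.rename
      (Sum.elim (fun v : S.1 => D.nodeVar' Z v.1) (fun z => Sum.inr (Sum.inr ⟨S, z⟩))) (θ S)

/-- The formula `μ_{|S|}` on the nodes of `S`, in the order given by `e`, and `|S| - 3`
auxiliary variables. -/
def muSep {V : Type*} (S : Finset V) (e : Fin S.card ≃ S) : CNF (S ⊕ Fin (S.card - 3)) :=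
  mu S.card (fun k => Lit.pos (Sum.inl (e k))) Sum.inr

/-- The formula `ε_{|S|}` on the nodes of `S`, in the order given by `e`, and `|S| - 3`
auxiliary variables. -/
def epsSep {V : Type*} (S : Finset V) (e : Fin S.card ≃ S) : CNF (S ⊕ Fin (S.card - 3)) :=
  eps S.card (fun k => Lit.pos (Sum.inl (e k))) Sum.inr

end NNF

/-- The substitution `[x_i = 1] ← x_i`, `[x_i = 0] ← ¬x_i` on literals. -/
def boolLit {ι Y : Type*} : Lit (DomVar (fun _ : ι => Bool) ⊕ Y) → Lit (ι ⊕ Y)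
  | ⟨Sum.inl ⟨i, b⟩, s⟩ => ⟨Sum.inl i, s == b⟩
  | ⟨Sum.inr y, s⟩ => ⟨Sum.inr y, s⟩

/-- The result of the substitutions `[x_i = 1] ← x_i` and `[x_i = 0] ← ¬x_i` in a formula. -/
def boolSubst {ι Y : Type*} (ψ : CNF (DomVar (fun _ : ι => Bool) ⊕ Y)) : CNF (ι ⊕ Y) :=
  CNF.mapLit boolLit ψ

end DNNFEnc

open DNNFEnc

/-!
# URC and PC encodings of smooth DNNFs

Unit resolution is analysed through *closed* sets of literals (`CNF.Closed`): consistent sets `U`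
that are closed under unit propagation and falsify no clause. If unit resolution does not refute
`φ ∧ α`, the derivable literals form a closed set containing `α`. So `φ` is unit refutation
complete if every closed set has a model, and propagation complete if, for every closed `U` and
every literal `l ∉ U`, the formula has a model containing `U` that falsifies `l`. Conversely,
a propagation complete formula has all these models (`CNF.PCOn.exists_model`).

Let `U` be closed for one of the encodings, and call a node alive if its negation is not in `U`.
The clauses N1, N2 and the unit clause on the root make the alive nodes a support: it contains the
root, an input of each of its disjunctions and all inputs of its conjunctions. Selecting one input
for each disjunction yields a certificate `T` (`NNF.IsCertificate`), a minimal satisfied subtree. By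
decomposability and smoothness, `T` meets each graph `D_i` in a path from the root to a leaf, so `T`
contains exactly one node of each separator and one leaf of each variable. Making the nodes in `T`
true and the others false satisfies the encoding.

This model contains `U`. Indeed, dead nodes are outside `T`; and if `p ≠ ρ` is in `U`, then `p` is
in a separator whose other nodes are dead by the at-most-one constraint, so the only node of `T` in
this separator is `p` (`NNF.mem_certificate_of_pos_mem`). This gives unit refutation completeness.
For propagation completeness, N3 allows certificates through any given alive node `q`
(`NNF.exists_certificate_mem`), which falsify `¬q`. If a node `v ≠ ρ` is not in `U`, then the
exactly-one constraint leaves another alive node in a separator of `v`, and a certificate through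
that node avoids `v`.

If the separator constraints use auxiliary variables, propagation completeness of `θ_S` provides
values for them: the node of `T` in `S` is alive, so `θ_S` has a model containing the literals of
`U` in which exactly this node of `S` is true. If a literal on an auxiliary variable is not in `U`,
then `θ_S` has a model falsifying it; the node of `S` that is true there is alive, and the
certificate is taken through this node.

The formulas `μ_m` and `ε_m` are themselves propagation complete, because they are ladders of direct
representations of constraints on three literals, glued along single variables (`IsLadder`,
`CNF.FalsifiesUnpropagated.glue`).

The substitution identifies the two domain variables of `x_i` with complementary literals. All
arguments take place before the substitution, for the preimage of a closed set under `boolLit`,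
which is again closed, and for assignments of the form `pullback a`.
-/

namespace DNNFEnc

/-! ### Sets of literals closed under unit propagation -/

namespace Lit

@[simp] theorem compl_compl {W : Type*} (l : Lit W) : l.compl.compl = l := by
  cases l; simp [compl]

@[simp] theorem compl_neg {W : Type*} (w : W) : (neg w).compl = pos w := rfl

@[simp] theorem holds_compl {W : Type*} (a : W → Bool) (l : Lit W) :
    l.compl.Holds a ↔ ¬ l.Holds a := by
  simp [Holds, compl, Bool.eq_not]

/-- Two literals on the same variable are equal or complementary. -/
theorem eq_or_eq_compl {W : Type*} {l g : Lit W} (h : l.var = g.var) :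
    l = g ∨ l = g.compl := by
  obtain ⟨v, s⟩ := l
  obtain ⟨w, t⟩ := g
  obtain rfl : v = w := h
  cases s <;> cases t <;> simp [compl]

/-- The map `σ` of literals is compatible with complementation, like every map obtained by
substituting literals for variables. -/
def CommutesCompl {W W' : Type*} (σ : Lit W → Lit W') : Prop :=
  ∀ l, σ l.compl = (σ l).compl

end Lit

namespace CNF

/-- `U` is a consistent set of literals that is closed under unit propagation in `φ` and falsifies
no clause of `φ`. -/
structure Closed {W : Type*} (φ : CNF W) (U : Set (Lit W)) : Prop where
  consistent : ∀ l ∈ U, l.compl ∉ U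
  exists_alive : ∀ C ∈ φ, ∃ l ∈ C, l.compl ∉ U
  propagate : ∀ C ∈ φ, ∀ l ∈ C, (∀ g ∈ C, g ≠ l → g.compl ∈ U) → l ∈ U

theorem Closed.mono {W : Type*} {φ φ' : CNF W} {U : Set (Lit W)} (h : Closed φ' U)
    (hsub : φ ⊆ φ') : Closed φ U :=
  ⟨h.consistent, fun C hC => h.exists_alive C (hsub hC), fun C hC => h.propagate C (hsub hC)⟩

/-- If a literal of a clause is not falsified but not in `U` either, then another literal of the
clause is not falsified. -/
theorem Closed.exists_other {W : Type*} {φ : CNF W} {U : Set (Lit W)} (h : Closed φ U)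
    {C : Clause W} (hC : C ∈ φ) {l : Lit W} (hl : l ∈ C) (hU : l ∉ U) :
    ∃ g ∈ C, g ≠ l ∧ g.compl ∉ U := by
  by_contra! hcon
  exact hU (h.propagate C hC l hl hcon)

theorem Closed.preimage {W W' : Type*} {φ : CNF W} {σ : Lit W → Lit W'} {U : Set (Lit W')}
    (hσ : Lit.CommutesCompl σ) (h : Closed (mapLit σ φ) U) : Closed φ (σ ⁻¹' U) := by
  refine ⟨fun l hl hl' => ?_, fun C hC => ?_, fun C hC l hl hg => ?_⟩
  · refine h.consistent _ hl ?_
    rw [← hσ]; exact hl'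
  · obtain ⟨m, ⟨l, hl, rfl⟩, hm⟩ := h.exists_alive _ ⟨C, hC, rfl⟩
    refine ⟨l, hl, ?_⟩
    rw [Set.mem_preimage, hσ]; exact hm
  · refine h.propagate _ ⟨C, hC, rfl⟩ _ ⟨l, hl, rfl⟩ ?_
    rintro _ ⟨g, hgC, rfl⟩ hne
    rw [← hσ]
    exact hg g hgC fun e => hne (by rw [e])

theorem sat_mapLit {W W' : Type*} {φ : CNF W} {σ : Lit W → Lit W'} {a : W → Bool}
    {a' : W' → Bool} (h : ∀ l, (σ l).Holds a' ↔ l.Holds a) :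
    Sat (mapLit σ φ) a' ↔ Sat φ a := by
  simp [Sat, mapLit, h]

theorem sat_andLits {W : Type*} {φ : CNF W} {α : Set (Lit W)} {a : W → Bool} :
    Sat (andLits φ α) a ↔ Sat φ a ∧ ∀ l ∈ α, l.Holds a := by
  simp only [Sat, andLits]
  constructor
  · intro h
    refine ⟨fun C hC => h C (Or.inl hC), fun l hl => ?_⟩
    simpa using h {l} (Or.inr ⟨l, hl, rfl⟩)
  · rintro ⟨h1, h2⟩ C (hC | ⟨l, hl, rfl⟩)
    · exact h1 C hC
    · exact ⟨l, rfl, h2 l hl⟩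

theorem UnitDerives.diff {W : Type*} {φ : CNF W} {C : Clause W} (hC : UnitDerives φ C)
    {F : Set (Lit W)} (hF : F.Finite) (h : ∀ l ∈ F, UnitDerives φ {l.compl}) :
    UnitDerives φ (C \ F) := by
  induction F, hF using Set.Finite.induction_on with
  | empty => simpa using hC
  | @insert l F hl _ ih =>
    have ih' := ih fun g hg => h g (Or.inr hg)
    have e : C \ insert l F = (C \ F) \ {l} := by
      ext g; simp; tauto
    rw [e]
    by_cases hm : l ∈ C \ F
    · exact ih'.resolve hm (h l (Or.inl rfl))
    · rwa [Set.sdiff_singleton_eq_self hm]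

/-- If unit resolution does not derive the empty clause, then the derivable literals are closed
under unit propagation. -/
theorem closed_of_not_unitDerives {W : Type*} [Finite W] {φ : CNF W}
    (h : ¬ UnitDerives φ ∅) : Closed φ {l | UnitDerives φ {l}} := by
  have : Finite (Lit W) := Finite.of_injective (fun l : Lit W => (l.var, l.sign)) (by
    rintro ⟨_, _⟩ ⟨_, _⟩ h; simpa using h)
  refine ⟨fun l hl hl' => h ?_, fun C hC => ?_, fun C hC l hl hg => ?_⟩
  · simpa using UnitDerives.resolve hl (Set.mem_singleton l) hl'
  · by_contra! hcon
    exact h (by simpa using (UnitDerives.ofMem hC).diff (Set.toFinite C) hcon)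
  · have := (UnitDerives.ofMem hC).diff (F := C \ {l}) (Set.toFinite _)
      fun g hgC => hg g hgC.1 hgC.2
    rwa [Set.sdiff_sdiff_cancel_left (by simpa using hl)] at this

/-- Every clause derivable from `φ ∧ U` arises from a clause of `φ ∧ U` by deleting literals
falsified by `U`, if `U` is closed. -/
theorem Closed.unitDerives {W : Type*} {φ : CNF W} {U : Set (Lit W)} (h : Closed φ U)
    {C : Clause W} (hC : UnitDerives (andLits φ U) C) :
    ∃ C₀ ∈ andLits φ U, C ⊆ C₀ ∧ ∀ l ∈ C₀, l ∉ C → l.compl ∈ U := by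
  have key : ∀ l : Lit W, (∃ C₀ ∈ andLits φ U, {l} ⊆ C₀ ∧ ∀ g ∈ C₀, g ∉ ({l} : Set (Lit W)) →
      g.compl ∈ U) → l ∈ U := by
    rintro l ⟨C₀, hC₀ | ⟨g, hg, rfl⟩, hl, hC⟩
    · exact h.propagate C₀ hC₀ l (hl rfl) hC
    · have : l = g := hl rfl
      exact this ▸ hg
  induction hC with
  | @ofMem C hC => exact ⟨C, hC, subset_rfl, fun l h1 h2 => absurd h1 h2⟩
  | @resolve C l _ _ _ ih1 ih2 =>
    obtain ⟨C₀, h0, hs, hd⟩ := ih1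
    refine ⟨C₀, h0, Set.sdiff_subset.trans hs, fun g hg hgn => ?_⟩
    by_cases hgl : g = l
    · subst hgl; exact key _ ih2
    · exact hd g hg fun hgC => hgn ⟨hgC, hgl⟩

theorem Closed.not_unitDerives_empty {W : Type*} {φ : CNF W} {U : Set (Lit W)}
    (h : Closed φ U) : ¬ UnitDerives (andLits φ U) ∅ := by
  intro hd
  obtain ⟨C₀, hC₀ | ⟨g, hg, rfl⟩, -, hC⟩ := h.unitDerives hd
  · obtain ⟨l, hl, hlU⟩ := h.exists_alive C₀ hC₀
    exact hlU (hC l hl (by simp))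
  · exact h.consistent g hg (hC g rfl (by simp))

theorem Closed.mem_of_unitDerives {W : Type*} {φ : CNF W} {U : Set (Lit W)}
    (h : Closed φ U) {l : Lit W} (hd : UnitDerives (andLits φ U) {l}) : l ∈ U := by
  obtain ⟨C₀, hC₀ | ⟨g, hg, rfl⟩, hl, hC⟩ := h.unitDerives hd
  · exact h.propagate C₀ hC₀ l (hl rfl) hC
  · have : l = g := hl rfl
    exact this ▸ hg

/-- In a propagation complete formula, a literal outside a closed set `U` can be falsified by a
model of `φ ∧ U`. -/
theorem PCOn.exists_model {W : Type*} {φ : CNF W} (h : PCOn φ Set.univ) {U : Set (Lit W)}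
    (hU : Closed φ U) {l : Lit W} (hl : l ∉ U) :
    ∃ a, Sat φ a ∧ (∀ g ∈ U, g.Holds a) ∧ ¬ l.Holds a := by
  by_contra! hcon
  rcases h U (fun _ _ => trivial) hU.consistent l trivial
    (fun a ha => by rw [sat_andLits] at ha; exact hcon a ha.1 ha.2) with hd | hd
  · exact hl (hU.mem_of_unitDerives hd)
  · exact hU.not_unitDerives_empty hd

theorem pcOn_univ_of_exists_model {W : Type*} [Finite W] {φ : CNF W}
    (h : ∀ U, Closed φ U → ∀ l ∉ U, ∃ a, Sat φ a ∧ (∀ g ∈ U, g.Holds a) ∧ ¬ l.Holds a) :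
    PCOn φ Set.univ := by
  intro α _ _ l _ hent
  by_contra! hcon
  have hcl := closed_of_not_unitDerives hcon.2
  obtain ⟨a, ha, haU, hal⟩ := h _ (hcl.mono Set.subset_union_left) l hcon.1
  exact hal (hent a (sat_andLits.2
    ⟨ha, fun g hg => haU g (UnitDerives.ofMem (Or.inr ⟨g, hg, rfl⟩))⟩))

theorem urcOn_univ_of_exists_model {W : Type*} [Finite W] {φ : CNF W}
    (h : ∀ U, Closed φ U → ∃ a, Sat φ a ∧ ∀ g ∈ U, g.Holds a) :
    URCOn φ Set.univ := by
  intro α _ _ hent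
  by_contra hcon
  have hcl := closed_of_not_unitDerives hcon
  obtain ⟨a, ha, haU⟩ := h _ (hcl.mono Set.subset_union_left)
  exact hent a (sat_andLits.2
    ⟨ha, fun g hg => haU g (UnitDerives.ofMem (Or.inr ⟨g, hg, rfl⟩))⟩)

end CNF

/-! ### Gluing propagation complete formulas along a variable -/

namespace CNF

/-- All variables of `φ` belong to `v`. -/
def VarsIn {W : Type*} (φ : CNF W) (v : Set W) : Prop := ∀ C ∈ φ, ∀ l ∈ C, l.var ∈ v

theorem Sat.congr {W : Type*} {φ : CNF W} {v : Set W} {a a' : W → Bool} (h : Sat φ a)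
    (hv : VarsIn φ v) (heq : ∀ w ∈ v, a' w = a w) : Sat φ a' := by
  intro C hC
  obtain ⟨l, hl, hla⟩ := h C hC
  exact ⟨l, hl, (heq _ (hv C hC l hl)).trans hla⟩

theorem sat_union {W : Type*} {φ φ' : CNF W} {a : W → Bool} :
    Sat (φ ∪ φ') a ↔ Sat φ a ∧ Sat φ' a := by
  simp [Sat, or_imp, forall_and]

/-- Propagation completeness on the variables in `v`, phrased in terms of closed sets: every literal
on `v` that is not propagated can be falsified by a model compatible with `U` on `v`. -/
def FalsifiesUnpropagated {W : Type*} (φ : CNF W) (v : Set W) : Prop :=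
  ∀ U, Closed φ U → ∀ l : Lit W, l.var ∈ v → l ∉ U →
    ∃ a, Sat φ a ∧ (∀ g ∈ U, g.var ∈ v → g.Holds a) ∧ ¬ l.Holds a

theorem FalsifiesUnpropagated.glue_left {W : Type*} {φ φ' : CNF W} {v v' : Set W} {y : W}
    (h : FalsifiesUnpropagated φ v) (h' : FalsifiesUnpropagated φ' v') (hv : VarsIn φ v)
    (hv' : VarsIn φ' v') (hy : y ∈ v) (hy' : y ∈ v') (hinter : ∀ w ∈ v, w ∈ v' → w = y)
    {U : Set (Lit W)} (hU : Closed (φ ∪ φ') U) {l : Lit W} (hl : l.var ∈ v) (hlU : l ∉ U) :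
    ∃ a, Sat (φ ∪ φ') a ∧ (∀ g ∈ U, g.var ∈ v ∪ v' → g.Holds a) ∧ ¬ l.Holds a := by
  classical
  obtain ⟨a, ha, haU, hal⟩ := h U (hU.mono Set.subset_union_left) l hl hlU
  -- the literal on `y` falsified by `a` is not propagated, so `φ'` has a model agreeing with `a`
  have hm : (⟨y, !a y⟩ : Lit W) ∉ U := fun hm => by
    have := haU _ hm hy
    simp [Lit.Holds] at this
  obtain ⟨a', ha', haU', hal'⟩ := h' U (hU.mono Set.subset_union_right) _ hy' hm
  have hyy : a y = a' y := by
    simpa [Lit.Holds] using (Ne.symm hal' : _)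
  let b : W → Bool := fun w => if w ∈ v then a w else a' w
  have hb : ∀ w ∈ v, b w = a w := fun w hw => if_pos hw
  have hb' : ∀ w ∈ v', b w = a' w := by
    intro w hw
    by_cases hwv : w ∈ v
    · obtain rfl := hinter w hwv hw
      exact (if_pos hwv).trans hyy
    · exact if_neg hwv
  refine ⟨b, sat_union.2 ⟨ha.congr hv hb, ha'.congr hv' hb'⟩, ?_, ?_⟩
  · rintro g hg (hgv | hgv)
    · exact (hb _ hgv).trans (haU g hg hgv)
    · exact (hb' _ hgv).trans (haU' g hg hgv)
  · intro hlb
    exact hal ((hb _ hl).symm.trans hlb)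

/-- The conjunction of two propagation complete formulas that share a single variable is
propagation complete. -/
theorem FalsifiesUnpropagated.glue {W : Type*} {φ φ' : CNF W} {v v' : Set W} {y : W}
    (h : FalsifiesUnpropagated φ v) (h' : FalsifiesUnpropagated φ' v') (hv : VarsIn φ v)
    (hv' : VarsIn φ' v') (hy : y ∈ v) (hy' : y ∈ v') (hinter : ∀ w ∈ v, w ∈ v' → w = y) :
    FalsifiesUnpropagated (φ ∪ φ') (v ∪ v') := by
  rintro U hU l (hl | hl) hlU
  · exact h.glue_left h' hv hv' hy hy' hinter hU hl hlU
  · rw [Set.union_comm φ] at hU ⊢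
    rw [Set.union_comm v]
    exact h'.glue_left h hv' hv hy' hy (fun w h1 h2 => hinter w h2 h1) hU hl hlU

end CNF

open CNF

/-! ### Direct representations of at-most-one and exactly-one -/

/-- The truth value of a literal. -/
def Lit.val {W : Type*} (a : W → Bool) (l : Lit W) : Bool := a l.var == l.sign

theorem Lit.val_eq_true {W : Type*} {a : W → Bool} {l : Lit W} :
    l.val a = true ↔ l.Holds a := by simp [Lit.val, Lit.Holds]

theorem Lit.val_neg {W : Type*} (a : W → Bool) (w : W) : (Lit.neg w).val a = !a w := by
  simp [Lit.val, Lit.neg]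

theorem Lit.val_pos {W : Type*} (a : W → Bool) (w : W) : (Lit.pos w).val a = a w := by
  simp [Lit.val, Lit.pos]

/-- The set of the variables of a family of literals. -/
def litVars {W : Type*} {n : ℕ} (x : Fin n → Lit W) : Set W := Set.range fun k => (x k).var

/-- The clauses stating that no two of the literals `x k` hold. -/
def amoLits {W : Type*} (n : ℕ) (x : Fin n → Lit W) : CNF W :=
  {C | ∃ j k, j ≠ k ∧ C = {(x j).compl, (x k).compl}}

/-- The clauses stating that exactly one of the literals `x k` holds. -/
def eoLits {W : Type*} (n : ℕ) (x : Fin n → Lit W) : CNF W :=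
  amoLits n x ∪ {Set.range x}

theorem varsIn_amoLits {W : Type*} {n : ℕ} (x : Fin n → Lit W) :
    VarsIn (amoLits n x) (litVars x) := by
  rintro C ⟨j, k, -, rfl⟩ l (rfl | rfl)
  · exact ⟨j, rfl⟩
  · exact ⟨k, rfl⟩

theorem varsIn_eoLits {W : Type*} {n : ℕ} (x : Fin n → Lit W) :
    VarsIn (eoLits n x) (litVars x) := by
  rintro C (hC | rfl)
  · exact varsIn_amoLits x C hC
  · rintro _ ⟨k, rfl⟩
    exact ⟨k, rfl⟩

theorem sat_amoLits {W : Type*} {n : ℕ} {x : Fin n → Lit W} {a : W → Bool} :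
    Sat (amoLits n x) a ↔ AtMostOne fun k => (x k).val a := by
  simp only [AtMostOne, Lit.val_eq_true]
  constructor
  · intro h j k hj hk
    by_contra hjk
    obtain ⟨l, rfl | rfl, hl⟩ := h _ ⟨j, k, hjk, rfl⟩
    · exact (Lit.holds_compl _ _).1 hl hj
    · exact (Lit.holds_compl _ _).1 hl hk
  · rintro h C ⟨j, k, hjk, rfl⟩
    by_cases hj : (x j).Holds a
    · exact ⟨_, Or.inr rfl, (Lit.holds_compl _ _).2 fun hk => hjk (h j k hj hk)⟩
    · exact ⟨_, Or.inl rfl, (Lit.holds_compl _ _).2 hj⟩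

theorem exactlyOne_iff_atMostOne {X : Type*} {p : X → Bool} :
    ExactlyOne p ↔ AtMostOne p ∧ ∃ u, p u = true := by
  constructor
  · rintro ⟨u, hu, huniq⟩
    exact ⟨fun v w hv hw => (huniq v hv).trans (huniq w hw).symm, u, hu⟩
  · rintro ⟨h, u, hu⟩
    exact ⟨u, hu, fun v hv => h v u hv hu⟩

theorem sat_eoLits {W : Type*} {n : ℕ} {x : Fin n → Lit W} {a : W → Bool} :
    Sat (eoLits n x) a ↔ ExactlyOne fun k => (x k).val a := by
  rw [eoLits, sat_union, sat_amoLits, exactlyOne_iff_atMostOne]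
  simp [Sat, Lit.val_eq_true]

/-- A total assignment in which prescribed literals on different variables have prescribed
values. -/
theorem exists_assignment {W : Type*} {n : ℕ} {x : Fin n → Lit W}
    (hx : Function.Injective fun k => (x k).var) (p : Fin n → Prop) :
    ∃ a : W → Bool, ∀ k, (x k).Holds a ↔ p k := by
  classical
  refine ⟨fun w => if h : ∃ k, (x k).var = w then
    (if p h.choose then (x h.choose).sign else !(x h.choose).sign) else false, fun k => ?_⟩
  have h : ∃ j, (x j).var = (x k).var := ⟨k, rfl⟩
  have e : h.choose = k := hx h.choose_spec
  rw [Lit.Holds, dif_pos h, e]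
  by_cases hp : p k <;> simp [hp]

/-- If `U` is closed and does not contain `¬x k`, then the assignment making `x k` the only true
literal is compatible with `U`. -/
theorem exists_single_of_closed {W : Type*} {n : ℕ} {x : Fin n → Lit W}
    (hx : Function.Injective fun k => (x k).var) {U : Set (Lit W)}
    (hU : Closed (amoLits n x) U) {k : Fin n} (hk : (x k).compl ∉ U) :
    ∃ a : W → Bool, (∀ j, (x j).Holds a ↔ j = k) ∧ ∀ g ∈ U, g.var ∈ litVars x → g.Holds a := by
  obtain ⟨a, ha⟩ := exists_assignment hx (· = k)
  refine ⟨a, ha, ?_⟩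
  rintro g hg ⟨j, hj⟩
  rcases Lit.eq_or_eq_compl hj with rfl | hjg
  · by_contra hjk
    rw [ha] at hjk
    obtain ⟨m, rfl | rfl, hne, hm⟩ := hU.exists_other ⟨k, j, fun e => hjk e.symm, rfl⟩
      (Or.inl rfl) hk
    · exact hne rfl
    · rw [Lit.compl_compl] at hm
      exact hm hg
  · obtain rfl : g = (x j).compl := by rw [hjg, Lit.compl_compl]
    rw [Lit.holds_compl, ha]
    rintro rfl
    exact hk hg

theorem falsifiesUnpropagated_amoLits {W : Type*} {n : ℕ} {x : Fin n → Lit W}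
    (hx : Function.Injective fun k => (x k).var) :
    FalsifiesUnpropagated (amoLits n x) (litVars x) := by
  rintro U hU l ⟨k, hk⟩ hlU
  have hsat : ∀ {a : W → Bool} {j}, (∀ i, (x i).Holds a ↔ i = j) → Sat (amoLits n x) a := by
    intro a j ha
    rw [sat_amoLits]
    intro u v hu hv
    rw [Lit.val_eq_true, ha] at hu hv
    rw [hu, hv]
  rcases Lit.eq_or_eq_compl hk with rfl | rfl'
  · by_cases hj : ∃ j, x j ∈ U
    · obtain ⟨j, hj⟩ := hj
      obtain ⟨a, ha, haU⟩ := exists_single_of_closed hx hU (hU.consistent _ hj)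
      refine ⟨a, hsat ha, haU, ?_⟩
      rw [ha]
      rintro rfl
      exact hlU hj
    · obtain ⟨a, ha⟩ := exists_assignment hx fun _ => False
      refine ⟨a, sat_amoLits.2 fun u v hu _ => ?_, ?_, by simp [ha]⟩
      · rw [Lit.val_eq_true, ha] at hu
        exact hu.elim
      · rintro g hg ⟨j, hjg⟩
        rcases Lit.eq_or_eq_compl hjg with rfl | hjg
        · exact (hj ⟨j, hg⟩).elim
        · obtain rfl : g = (x j).compl := by rw [hjg, Lit.compl_compl]
          simp [ha]
  · obtain rfl : l = (x k).compl := by rw [rfl', Lit.compl_compl]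
    obtain ⟨a, ha, haU⟩ := exists_single_of_closed hx hU hlU
    exact ⟨a, hsat ha, haU, by simp [ha]⟩

theorem falsifiesUnpropagated_eoLits {W : Type*} {n : ℕ} {x : Fin n → Lit W}
    (hx : Function.Injective fun k => (x k).var) :
    FalsifiesUnpropagated (eoLits n x) (litVars x) := by
  rintro U hU l ⟨k, hk⟩ hlU
  have hU' : Closed (amoLits n x) U := hU.mono Set.subset_union_left
  have hsat : ∀ {a : W → Bool} {j}, (∀ i, (x i).Holds a ↔ i = j) → Sat (eoLits n x) a := by
    intro a j ha
    rw [sat_eoLits]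
    exact ⟨j, Lit.val_eq_true.2 ((ha j).2 rfl), fun u hu => (ha u).1 (Lit.val_eq_true.1 hu)⟩
  rcases Lit.eq_or_eq_compl hk with rfl | rfl'
  · obtain ⟨_, ⟨j, rfl⟩, hne, hj⟩ := hU.exists_other (Or.inr rfl) ⟨k, rfl⟩ hlU
    obtain ⟨a, ha, haU⟩ := exists_single_of_closed hx hU' hj
    refine ⟨a, hsat ha, haU, ?_⟩
    rw [ha]
    rintro rfl
    exact hne rfl
  · obtain rfl : l = (x k).compl := by rw [rfl', Lit.compl_compl]
    obtain ⟨a, ha, haU⟩ := exists_single_of_closed hx hU' hlU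
    exact ⟨a, hsat ha, haU, by simp [ha]⟩

theorem mu_eq_amoLits {W : Type*} {n : ℕ} (hn : n ≤ 3) (x : Fin n → Lit W)
    (y : Fin (n - 3) → W) : mu n x y = amoLits n x := by
  interval_cases n <;> ext C <;>
    simp [mu, amoLits, Fin.exists_fin_succ, Set.pair_comm]
  grind [Set.pair_comm]

theorem eps_eq_eoLits {W : Type*} {n : ℕ} (hn : n ≤ 3) (x : Fin n → Lit W)
    (y : Fin (n - 3) → W) : eps n x y = eoLits n x := by
  have hr : ∀ l, l ∈ Set.range x ↔ ∃ k, x k = l := fun _ => Iff.rfl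
  rw [eoLits, ← mu_eq_amoLits hn x y]
  interval_cases n
  · simp [eps, mu, Set.range_eq_empty]
  · have : Set.range x = {x 0} := by ext; simp [hr, Fin.exists_fin_succ, eq_comm]
    simp [eps, mu, this]
  · have : Set.range x = {x 0, x 1} := by ext; simp [hr, Fin.exists_fin_succ, eq_comm]
    rw [this]; rfl
  · have : Set.range x = {x 0, x 1, x 2} := by ext; simp [hr, Fin.exists_fin_succ, eq_comm]
    rw [this]
    ext C
    simp [eps, eps3, mu]
    tauto

/-! ### Ladders of direct representations -/

theorem atMostOne_succ {n : ℕ} (p : Fin (n + 1) → Bool) :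
    AtMostOne p ↔ (p 0 = true → ∀ k : Fin n, p k.succ = false) ∧
      AtMostOne fun k : Fin n => p k.succ := by
  simp only [AtMostOne, Fin.forall_fin_succ (n := n)]
  cases h : p 0 <;> simp [Fin.succ_ne_zero, (Fin.succ_ne_zero _).symm]
  grind

theorem atMostOne_three (a b c : Bool) :
    AtMostOne ![a, b, c] ↔ (a = true → b = false ∧ c = false) ∧ (b = true → c = false) := by
  have hemp : ∀ q : Fin 0 → Bool, AtMostOne q := fun _ u => u.elim0
  simp [atMostOne_succ, hemp, Fin.forall_fin_succ]

/-- The value of `y` that works is the disjunction of the first two values. -/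
theorem atMostOne_split {n : ℕ} (p : Fin (n + 4) → Bool) :
    AtMostOne p ↔ ∃ y : Bool, AtMostOne ![p 0, p 1, !y] ∧
      AtMostOne (Fin.cons y fun k : Fin (n + 2) => p k.succ.succ : Fin (n + 3) → Bool) := by
  have h01 : (0 : Fin (n + 3)).succ = 1 := rfl
  rw [atMostOne_succ, atMostOne_succ (fun k : Fin (n + 3) => p k.succ)]
  simp only [atMostOne_three, atMostOne_succ (n := n + 2) (Fin.cons _ _), Fin.cons_zero,
    Fin.cons_succ, Bool.exists_bool, Fin.forall_fin_succ (n := n + 2), h01]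
  generalize (fun k : Fin (n + 2) => p k.succ.succ) = q
  cases p 0 <;> cases p 1 <;> simp

/-- The value of `y` that works is the disjunction of the first two values. -/
theorem exactlyOne_split {n : ℕ} (p : Fin (n + 4) → Bool) :
    ExactlyOne p ↔ ∃ y : Bool, ExactlyOne ![p 0, p 1, !y] ∧
      ExactlyOne (Fin.cons y fun k : Fin (n + 2) => p k.succ.succ : Fin (n + 3) → Bool) := by
  have h01 : (0 : Fin (n + 3)).succ = 1 := rfl
  simp only [exactlyOne_iff_atMostOne]
  rw [atMostOne_succ, atMostOne_succ (fun k : Fin (n + 3) => p k.succ)]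
  simp only [atMostOne_three, atMostOne_succ (n := n + 2) (Fin.cons _ _), Fin.cons_zero,
    Fin.cons_succ, Bool.exists_bool, Fin.forall_fin_succ (n := n + 2),
    Fin.exists_fin_succ (n := n + 2), Fin.exists_fin_succ (n := n + 3), h01]
  generalize (fun k : Fin (n + 2) => p k.succ.succ) = q
  cases p 0 <;> cases p 1 <;> simp [Fin.exists_fin_succ]

/-- A family of formulas on literals `x` and auxiliary variables `y` that coincides with the
direct representation `R` up to three literals, and that otherwise splits off a copy of `R 3`, the
first auxiliary variable replacing the first two literals. -/
structure IsLadder {W : Type*} (R : ∀ n, (Fin n → Lit W) → CNF W)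
    (F : ∀ n, (Fin n → Lit W) → (Fin (n - 3) → W) → CNF W) : Prop where
  base : ∀ n ≤ 3, ∀ x y, F n x y = R n x
  step : ∀ (n : ℕ) (x : Fin (n + 4) → Lit W) (y : Fin (n + 1) → W),
    F (n + 4) x y = R 3 ![x 0, x 1, Lit.neg (y 0)] ∪
      F (n + 3) (Fin.cons (Lit.pos (y 0)) fun k : Fin (n + 2) => x k.succ.succ)
        (fun k : Fin n => y k.succ)

theorem isLadder_mu {W : Type*} : IsLadder (W := W) amoLits mu :=
  ⟨fun n hn x y => mu_eq_amoLits hn x y, fun n x y => by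
    rw [← mu_eq_amoLits le_rfl _ Fin.elim0]
    simp [mu]⟩

theorem isLadder_eps {W : Type*} : IsLadder (W := W) eoLits eps :=
  ⟨fun n hn x y => eps_eq_eoLits hn x y, fun n x y => by
    rw [← eps_eq_eoLits le_rfl _ Fin.elim0]
    simp [eps]⟩

/-- The variables of a family of literals together with auxiliary variables. -/
def ladderVars {W : Type*} {n m : ℕ} (x : Fin n → Lit W) (y : Fin m → W) : Set W :=
  litVars x ∪ Set.range y

theorem ladderVars_step {W : Type*} {n : ℕ} (x : Fin (n + 4) → Lit W) (y : Fin (n + 1) → W) :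
    ladderVars x y = litVars ![x 0, x 1, Lit.neg (y 0)] ∪
      ladderVars (Fin.cons (Lit.pos (y 0)) fun k : Fin (n + 2) => x k.succ.succ : Fin (n + 3) → _)
        (fun k : Fin n => y k.succ) := by
  ext w
  simp only [ladderVars, litVars, Set.mem_union, Set.mem_range, Fin.exists_fin_succ (n := n),
    Fin.exists_fin_succ (n := n + 2), Fin.exists_fin_succ (n := n + 3)]
  simp [Fin.exists_fin_succ, Lit.pos, Lit.neg]
  tauto

namespace IsLadder

variable {W : Type*} {R : ∀ n, (Fin n → Lit W) → CNF W}
  {F : ∀ n, (Fin n → Lit W) → (Fin (n - 3) → W) → CNF W}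

/-- Induction along the ladder: the formula may be forgotten in favour of a property `P` of it. -/
theorem induction (h : IsLadder R F)
    (P : ∀ n, (Fin n → Lit W) → (Fin (n - 3) → W) → CNF W → Prop)
    (base : ∀ n ≤ 3, ∀ x y, P n x y (R n x))
    (step : ∀ (n : ℕ) (x : Fin (n + 4) → Lit W) (y : Fin (n + 1) → W) (φ : CNF W),
      P (n + 3) (Fin.cons (Lit.pos (y 0)) fun k : Fin (n + 2) => x k.succ.succ)
        (fun k : Fin n => y k.succ) φ →
      P (n + 4) x y (R 3 ![x 0, x 1, Lit.neg (y 0)] ∪ φ)) :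
    ∀ n x y, P n x y (F n x y) := by
  have small : ∀ n ≤ 3, ∀ x y, P n x y (F n x y) := fun n hn x y => by
    rw [h.base n hn]; exact base n hn x y
  have big : ∀ n, ∀ (x : Fin (n + 3) → Lit W) (y : Fin n → W), P (n + 3) x y (F (n + 3) x y) := by
    intro n
    induction n with
    | zero => exact small 3 le_rfl
    | succ n ih =>
      intro x y
      rw [h.step n x y]
      exact step n x y _ (ih _ _)
  intro n
  by_cases hn : n ≤ 3
  · exact small n hn
  · obtain ⟨m, rfl⟩ : ∃ m, n = m + 3 := ⟨n - 3, by omega⟩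
    exact big m

/-- Each step of a ladder glues two formulas that share only the variable `y 0`. -/
theorem falsifiesUnpropagated (h : IsLadder R F) (hR : ∀ n x, VarsIn (R n x) (litVars x))
    (hpc : ∀ n (x : Fin n → Lit W), (Function.Injective fun k => (x k).var) →
      FalsifiesUnpropagated (R n x) (litVars x)) (n : ℕ)
    (x : Fin n → Lit W) (y : Fin (n - 3) → W)
    (hxy : Function.Injective (Sum.elim (fun k => (x k).var) y)) :
    FalsifiesUnpropagated (F n x y) (ladderVars x y) := by
  have main := h.induction (fun n x y φ => VarsIn φ (ladderVars x y) ∧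
    (Function.Injective (Sum.elim (fun k => (x k).var) y) →
      FalsifiesUnpropagated φ (ladderVars x y))) ?_ ?_ n x y
  · exact main.2 hxy
  · intro n hn x y
    have : IsEmpty (Fin (n - 3)) := by
      rw [Nat.sub_eq_zero_of_le hn]; infer_instance
    have e : ladderVars x y = litVars x := by simp [ladderVars, Set.range_eq_empty]
    rw [e]
    exact ⟨hR n x, fun hinj => hpc n x (hinj.comp Sum.inl_injective)⟩
  · intro n x y φ ⟨hv, ih⟩
    change VarsIn _ (ladderVars x y) ∧ (Function.Injective (Sum.elim (fun k => (x k).var) y) →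
      FalsifiesUnpropagated _ (ladderVars x y))
    refine ⟨?_, fun hinj => ?_⟩
    · rw [ladderVars_step x y]
      rintro C (hC | hC) l hl
      · exact Or.inl (hR _ _ C hC l hl)
      · exact Or.inr (hv C hC l hl)
    · rw [ladderVars_step x y]
      rw [Sum.elim_injective] at hinj
      obtain ⟨hx, hy, hne⟩ := hinj
      refine (hpc 3 _ ?_).glue (ih ?_) (hR 3 _) hv (y := y 0) ⟨2, rfl⟩ (Or.inl ⟨0, rfl⟩) ?_
      · intro j k
        fin_cases j <;> fin_cases k <;>
          simp [Lit.neg, hx.eq_iff, hne, (hne _ _).symm]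
      · rw [Sum.elim_injective]
        refine ⟨fun j k => ?_, fun j k hjk => Fin.succ_injective _ (hy hjk), fun j k => ?_⟩
        · cases j using Fin.cases <;> cases k using Fin.cases <;>
            simp [Lit.pos, hx.eq_iff, hne, (hne _ _).symm]
        · cases j using Fin.cases <;> simp [Lit.pos, hy.eq_iff, hne, (Fin.succ_ne_zero _).symm]
      · have h1 : ∀ k : Fin (n + 2), (1 : Fin (n + 4)) ≠ k.succ.succ := fun k h => by
          have := congrArg Fin.val h
          simp at this
        rintro _ ⟨j, rfl⟩ hw
        simp only [ladderVars, litVars, Set.mem_union, Set.mem_range,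
          Fin.exists_fin_succ (n := n + 2)] at hw
        fin_cases j
        · rcases hw with (h | ⟨k, h⟩) | ⟨k, h⟩
          · exact (hne _ _ h.symm).elim
          · exact (Fin.succ_ne_zero _ (hx h)).elim
          · exact (hne _ _ h.symm).elim
        · rcases hw with (h | ⟨k, h⟩) | ⟨k, h⟩
          · exact (hne _ _ h.symm).elim
          · exact (h1 _ (hx h).symm).elim
          · exact (hne _ _ h.symm).elim
        · rfl

/-- If the constraint `P` on `n + 4` truth values splits off its first two arguments in the way
the ladder does, then the ladder encodes `P`. -/
theorem exists_sat_iff (h : IsLadder R F) (P : ∀ {n : ℕ}, (Fin n → Bool) → Prop)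
    (hsplit : ∀ {n : ℕ} (p : Fin (n + 4) → Bool), P p ↔ ∃ y : Bool, P ![p 0, p 1, !y] ∧
      P (Fin.cons y fun k : Fin (n + 2) => p k.succ.succ : Fin (n + 3) → Bool))
    (hR : ∀ n x a, Sat (R n x) a ↔ P fun k => (x k).val a)
    (n : ℕ) (x : Fin n → Lit W) (y : Fin (n - 3) → W)
    (hxy : Function.Injective (Sum.elim (fun k => (x k).var) y)) (a : W → Bool) :
    (P fun k => (x k).val a) ↔
      ∃ a', (∀ w, w ∉ Set.range y → a' w = a w) ∧ Sat (F n x y) a' := by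
  classical
  revert hxy a
  refine h.induction (fun n x y φ => Function.Injective (Sum.elim (fun k => (x k).var) y) →
    ∀ a, (P fun k => (x k).val a) ↔ ∃ a', (∀ w, w ∉ Set.range y → a' w = a w) ∧ Sat φ a')
    ?_ ?_ n x y
  · intro n hn x y _ a
    have : IsEmpty (Fin (n - 3)) := by
      rw [Nat.sub_eq_zero_of_le hn]; infer_instance
    rw [← hR]
    refine ⟨fun ha => ⟨a, fun _ _ => rfl, ha⟩, ?_⟩
    rintro ⟨a', ha', hsat⟩
    have : a' = a := funext fun w => ha' w (by simp [Set.range_eq_empty])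
    exact this ▸ hsat
  · intro n x (y : Fin (n + 1) → W) φ ih (hinj : Function.Injective (Sum.elim _ y)) a
    rw [Sum.elim_injective] at hinj
    obtain ⟨hx, hy, hne⟩ := hinj
    have ih := ih (by
      rw [Sum.elim_injective]
      refine ⟨fun j k => ?_, fun j k hjk => Fin.succ_injective _ (hy hjk), fun j k => ?_⟩
      · cases j using Fin.cases <;> cases k using Fin.cases <;>
          simp [Lit.pos, hx.eq_iff, hne, (hne _ _).symm]
      · cases j using Fin.cases <;> simp [Lit.pos, hy.eq_iff, hne, (Fin.succ_ne_zero _).symm])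
    have hval : ∀ (l : Lit W) (a a' : W → Bool), a l.var = a' l.var → l.val a = l.val a' :=
      fun l a a' e => by simp [Lit.val, e]
    have hcons : ∀ a' : W → Bool, (∀ k, a' (x k).var = a (x k).var) →
        (fun k : Fin (n + 3) => ((Fin.cons (Lit.pos (y 0)) fun k : Fin (n + 2) => x k.succ.succ :
          Fin (n + 3) → Lit W) k).val a') =
        (Fin.cons (a' (y 0)) fun k : Fin (n + 2) => (x k.succ.succ).val a : Fin (n + 3) → Bool) := by
      intro a' ha'
      funext k
      cases k using Fin.cases with
      | zero => simp [Lit.val_pos]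
      | succ k => simpa using hval _ _ _ (ha' _)
    have hthree : ∀ a' : W → Bool, (∀ k, a' (x k).var = a (x k).var) →
        (fun k : Fin 3 => (![x 0, x 1, Lit.neg (y 0)] k).val a') =
          ![(x 0).val a, (x 1).val a, !a' (y 0)] := by
      intro a' ha'
      funext k
      fin_cases k
      · exact hval _ _ _ (ha' _)
      · exact hval _ _ _ (ha' _)
      · simp [Lit.val_neg]
    rw [hsplit]
    constructor
    · rintro ⟨b, hb3, hb⟩
      have hup : ∀ k, Function.update a (y 0) b (x k).var = a (x k).var :=
        fun k => Function.update_of_ne (hne k 0) _ _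
      have hcons' := hcons _ hup
      rw [Function.update_self] at hcons'
      rw [← hcons', ih] at hb
      obtain ⟨a', ha', hsat⟩ := hb
      have hxk : ∀ k, a' (x k).var = a (x k).var := fun k => by
        rw [ha', hup]
        rintro ⟨j, hj⟩
        exact hne _ _ hj.symm
      have hy0 : a' (y 0) = b := by
        rw [ha', Function.update_self]
        rintro ⟨j, hj⟩
        exact Fin.succ_ne_zero _ (hy hj)
      refine ⟨a', fun w hw => ?_, sat_union.2 ⟨?_, hsat⟩⟩
      · rw [ha', Function.update_of_ne]
        · rintro rfl
          exact hw ⟨(0 : Fin (n + 1)), rfl⟩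
        · rintro ⟨j, rfl⟩
          exact hw ⟨j.succ, rfl⟩
      · rw [hR, hthree a' hxk, hy0]
        exact hb3
    · rintro ⟨a', ha', hsat⟩
      rw [sat_union] at hsat
      have hxk : ∀ k, a' (x k).var = a (x k).var := fun k => by
        rw [ha']
        rintro ⟨j, hj⟩
        exact hne _ j hj.symm
      refine ⟨a' (y 0), ?_, ?_⟩
      · rw [← hthree a' hxk, ← hR]
        exact hsat.1
      · rw [← hcons a' hxk, ih]
        exact ⟨a', fun _ _ => rfl, hsat.2⟩

end IsLadder

theorem atMostOne_comp_equiv {X X' : Type*} (e : X' ≃ X) (p : X → Bool) :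
    (AtMostOne fun k => p (e k)) ↔ AtMostOne p := by
  refine ⟨fun h u v hu hv => ?_, fun h u v hu hv => e.injective (h _ _ hu hv)⟩
  have := h (e.symm u) (e.symm v) (by simpa using hu) (by simpa using hv)
  exact e.symm.injective this

theorem exactlyOne_comp_equiv {X X' : Type*} (e : X' ≃ X) (p : X → Bool) :
    (ExactlyOne fun k => p (e k)) ↔ ExactlyOne p :=
  e.existsUnique_congr_right (q := fun u => p u = true)

/-- A ladder of direct representations of a constraint `P`, applied to the elements of `S`, is a
propagation complete encoding of `P`. -/
theorem IsLadder.isPCEncoding {V : Type*} {S : Finset V} (e : Fin S.card ≃ S)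
    {R : ∀ n, (Fin n → Lit (S ⊕ Fin (S.card - 3))) → CNF (S ⊕ Fin (S.card - 3))}
    {F : ∀ n, (Fin n → Lit (S ⊕ Fin (S.card - 3))) →
      (Fin (n - 3) → S ⊕ Fin (S.card - 3)) → CNF (S ⊕ Fin (S.card - 3))}
    (h : IsLadder R F) (P : ∀ {n : ℕ}, (Fin n → Bool) → Prop) {Q : (S → Bool) → Prop}
    (hequiv : ∀ p : S → Bool, (P fun k => p (e k)) ↔ Q p)
    (hsplit : ∀ {n : ℕ} (p : Fin (n + 4) → Bool), P p ↔ ∃ y : Bool, P ![p 0, p 1, !y] ∧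
      P (Fin.cons y fun k : Fin (n + 2) => p k.succ.succ : Fin (n + 3) → Bool))
    (hR : ∀ n x a, Sat (R n x) a ↔ P fun k => (x k).val a)
    (hv : ∀ n x, VarsIn (R n x) (litVars x))
    (hpc : ∀ n x, (Function.Injective fun k => (x k).var) →
      FalsifiesUnpropagated (R n x) (litVars x)) :
    IsPCEncoding Q (F S.card (fun k => Lit.pos (Sum.inl (e k))) Sum.inr) := by
  have hinj : Function.Injective (Sum.elim (fun k => (Lit.pos (Sum.inl (e k)) :
      Lit (S ⊕ Fin (S.card - 3))).var) Sum.inr) := by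
    rw [Sum.elim_injective]
    exact ⟨Sum.inl_injective.comp e.injective, Sum.inr_injective, fun _ _ => Sum.inl_ne_inr⟩
  constructor
  · intro a
    rw [← hequiv]
    have := h.exists_sat_iff P hsplit hR S.card _ _ hinj (Sum.elim a fun _ => false)
    simp only [Lit.val_pos, Sum.elim_inl] at this
    rw [this]
    constructor
    · rintro ⟨a', ha', hsat⟩
      refine ⟨fun z => a' (Sum.inr z), ?_⟩
      convert hsat
      funext w
      rcases w with w | w
      · simp [ha']
      · rfl
    · rintro ⟨b, hb⟩
      refine ⟨_, ?_, hb⟩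
      rintro (w | w) hw
      · rfl
      · exact (hw ⟨w, rfl⟩).elim
  · have hall : ∀ w, w ∈ ladderVars (fun k => (Lit.pos (Sum.inl (e k)) :
        Lit (S ⊕ Fin (S.card - 3)))) Sum.inr := by
      rintro (w | w)
      · exact Or.inl ⟨e.symm w, by simp [Lit.pos]⟩
      · exact Or.inr ⟨w, rfl⟩
    refine pcOn_univ_of_exists_model fun U hU l hl => ?_
    obtain ⟨a, ha, haU, hal⟩ := h.falsifiesUnpropagated hv hpc S.card _ _ hinj U hU l (hall _) hl
    exact ⟨a, ha, fun g hg => haU g hg (hall _), hal⟩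

theorem isPCEncoding_muSep {V : Type*} (S : Finset V) (e : Fin S.card ≃ S) :
    IsPCEncoding AtMostOne (NNF.muSep S e) :=
  isLadder_mu.isPCEncoding e AtMostOne (atMostOne_comp_equiv e) atMostOne_split
    (fun _ _ _ => sat_amoLits) (fun _ x => varsIn_amoLits x)
    fun _ _ hx => falsifiesUnpropagated_amoLits hx

theorem isPCEncoding_epsSep {V : Type*} (S : Finset V) (e : Fin S.card ≃ S) :
    IsPCEncoding ExactlyOne (NNF.epsSep S e) :=
  isLadder_eps.isPCEncoding e ExactlyOne (exactlyOne_comp_equiv e) exactlyOne_split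
    (fun _ _ _ => sat_eoLits) (fun _ x => varsIn_eoLits x)
    fun _ _ hx => falsifiesUnpropagated_eoLits hx

/-! ### Certificates in smooth DNNFs -/

namespace NNF

variable {ι : Type*} {dom : ι → Type*} {V : Type*} (D : NNF dom V)

theorem wellFounded_edge [Finite V] : WellFounded D.edge := by
  have : IsTrans V (Relation.TransGen D.edge) := ⟨fun _ _ _ => Relation.TransGen.trans⟩
  have : Std.Irrefl (Relation.TransGen D.edge) := ⟨D.acyclic⟩
  exact Subrelation.wf (fun h => Relation.TransGen.single h)
    (Finite.wellFounded_of_trans_of_irrefl (Relation.TransGen D.edge))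

theorem wellFounded_input [Finite V] : WellFounded fun u v => D.edge v u := by
  have : IsTrans V (fun u v => Relation.TransGen D.edge v u) :=
    ⟨fun _ _ _ h h' => Relation.TransGen.trans h' h⟩
  have : Std.Irrefl (fun u v => Relation.TransGen D.edge v u) := ⟨D.acyclic⟩
  exact Subrelation.wf (fun h => Relation.TransGen.single h)
    (Finite.wellFounded_of_trans_of_irrefl (fun u v => Relation.TransGen D.edge v u))

variable {D}

theorem not_edge_root {v : V} : ¬ D.edge v D.root := fun h =>
  D.acyclic _ (Relation.TransGen.tail' (D.reachable v) h)

theorem not_edge_of_leaf {v u : V} {d : DomVar dom} (h : D.label v = NodeLabel.leaf d) :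
    ¬ D.edge v u := (D.leaf_iff v).1 ⟨d, h⟩ u

theorem mem_H_of_edge {v u : V} {i : ι} (h : D.edge v u) (hu : u ∈ D.H i) : v ∈ D.H i := by
  obtain ⟨w, s, hw, hl⟩ := hu
  exact ⟨w, s, hw.head h, hl⟩

theorem mem_H_root (i : ι) : D.root ∈ D.H i := by
  obtain ⟨v, s, h⟩ := D.occurs i
  exact ⟨v, s, D.reachable v, h⟩

theorem mem_H_of_leaf {v : V} {i : ι} {s : dom i} (h : D.label v = NodeLabel.leaf ⟨i, s⟩) :
    v ∈ D.H i := ⟨v, s, .refl, h⟩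

theorem exists_leaf_of_mem_H {v : V} {i : ι} {d : DomVar dom} (h : D.label v = NodeLabel.leaf d)
    (hv : v ∈ D.H i) : ∃ s, D.label v = NodeLabel.leaf ⟨i, s⟩ := by
  obtain ⟨u, s, hu, hl⟩ := hv
  rcases hu.cases_head with rfl | ⟨w, hw, -⟩
  · exact ⟨s, hl⟩
  · exact (not_edge_of_leaf h hw).elim

/-- An inner node with `x_i` among its variables has an input with this property. -/
theorem exists_edge_mem_H {v : V} {i : ι} (h : ∀ d, D.label v ≠ NodeLabel.leaf d)
    (hv : v ∈ D.H i) : ∃ u, D.edge v u ∧ u ∈ D.H i := by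
  obtain ⟨u, s, hu, hl⟩ := hv
  rcases hu.cases_head with rfl | ⟨w, hw, hwu⟩
  · exact (h _ hl).elim
  · exact ⟨w, hw, u, s, hwu, hl⟩

theorem exists_mem_H [Finite V] (v : V) : ∃ i, v ∈ D.H i := by
  induction v using D.wellFounded_input.induction with
  | _ v ih =>
  by_cases h : ∃ d, D.label v = NodeLabel.leaf d
  · obtain ⟨⟨i, s⟩, hd⟩ := h
    exact ⟨i, mem_H_of_leaf hd⟩
  · rw [D.leaf_iff] at h
    push Not at h
    obtain ⟨u, hu⟩ := h
    obtain ⟨i, hi⟩ := ih u hu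
    exact ⟨i, mem_H_of_edge hu hi⟩

variable (D) in
/-- The set `A` of nodes contains the root, an input of each of its disjunctions, and all inputs
of its conjunctions. -/
structure IsSupport (A : Set V) : Prop where
  root_mem : D.root ∈ A
  disj : ∀ v ∈ A, D.label v = NodeLabel.disj → ∃ u ∈ A, D.edge v u
  conj : ∀ v ∈ A, D.label v = NodeLabel.conj → ∀ u, D.edge v u → u ∈ A

variable (D) in
/-- A certificate (a minimal satisfied subtree): a support whose nodes are reached from the root
inside it, and that intersects each `D_i` in a single path, so that it contains exactly one leaf
of each variable and exactly one node of each separator. -/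
structure IsCertificate (T : Set V) : Prop extends D.IsSupport T where
  parent : ∀ v ∈ T, v ≠ D.root → ∃ p ∈ T, D.edge p v
  leaf : ∀ i, ∃ w ∈ T, ∃ s, D.label w = NodeLabel.leaf ⟨i, s⟩ ∧
    ∀ w' ∈ T, ∀ s', D.label w' = NodeLabel.leaf ⟨i, s'⟩ → w' = w
  separator : ∀ i S, D.IsSeparator i S → ∃! v, v ∈ T ∧ v ∈ S

variable (D) in
/-- The edges that remain when each disjunction `v` keeps only the input `c v`. -/
def Selected (c : V → V) (v u : V) : Prop :=
  D.edge v u ∧ (D.label v = NodeLabel.disj → u = c v)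

theorem reflTransGen_edge_of_selected {c : V → V} {v u : V}
    (h : Relation.ReflTransGen (D.Selected c) v u) : Relation.ReflTransGen D.edge v u :=
  Relation.ReflTransGen.mono (fun _ _ h => h.1) _ _ h

/-- Changing the input selected at `p` does not affect the paths that end in `p`, since no earlier
node on such a path equals `p`. -/
theorem reflTransGen_selected_update [DecidableEq V] {c : V → V} {a p : V}
    (h : Relation.ReflTransGen (D.Selected c) a p) (q : V) :
    Relation.ReflTransGen (D.Selected (Function.update c p q)) a p := by
  induction h using Relation.ReflTransGen.head_induction_on with
  | refl => exact .refl
  | @head a b hab hbp ih =>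
    refine ih.head ⟨hab.1, fun hl => ?_⟩
    rw [Function.update_of_ne]
    · exact hab.2 hl
    · rintro rfl
      exact D.acyclic _ (Relation.TransGen.head' hab.1 (reflTransGen_edge_of_selected hbp))

/-- The nodes of `D_i` that are reachable by selected edges form a path. -/
theorem exists_selected_path [Finite V] (hdec : D.Decomposable) (hsmooth : D.Smooth) {c : V → V}
    (hc : ∀ v, Relation.ReflTransGen (D.Selected c) D.root v → D.label v = NodeLabel.disj →
      D.edge v (c v)) (i : ι) (v : V) (hv : v ∈ D.H i)
    (hroot : Relation.ReflTransGen (D.Selected c) D.root v) :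
    ∃ p : List V, p.head? = some v ∧ p.IsChain D.edge ∧
      (∀ w, w ∈ p ↔ Relation.ReflTransGen (D.Selected c) v w ∧ w ∈ D.H i) ∧
      ∃ w s, p.getLast? = some w ∧ D.label w = NodeLabel.leaf ⟨i, s⟩ ∧
        ∀ w' ∈ p, ∀ s', D.label w' = NodeLabel.leaf ⟨i, s'⟩ → w' = w := by
  induction v using D.wellFounded_input.induction with
  | _ v ih =>
  by_cases hleaf : ∃ d, D.label v = NodeLabel.leaf d
  · obtain ⟨d, hd⟩ := hleaf
    obtain ⟨s, hs⟩ := exists_leaf_of_mem_H hd hv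
    refine ⟨[v], rfl, List.isChain_singleton v, fun w => ?_, v, s, rfl, hs, by simp⟩
    rw [List.mem_singleton]
    constructor
    · rintro rfl
      exact ⟨.refl, hv⟩
    · rintro ⟨hw, -⟩
      rcases hw.cases_head with rfl | ⟨u, hu, -⟩
      · rfl
      · exact (not_edge_of_leaf hd hu.1).elim
  · push Not at hleaf
    -- smoothness and decomposability leave a single way to continue inside `D_i`
    have hnext : ∃ u, D.Selected c v u ∧ u ∈ D.H i ∧
        ∀ u', D.Selected c v u' → u' ∈ D.H i → u' = u := by
      cases hl : D.label v with
      | leaf d => exact (hleaf d hl).elim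
      | disj =>
        refine ⟨c v, ⟨hc v hroot hl, fun _ => rfl⟩, ?_, fun u' hu' _ => hu'.2 hl⟩
        change i ∈ D.vars (c v)
        rw [hsmooth v hl _ (hc v hroot hl)]
        exact hv
      | conj =>
        obtain ⟨u, hu, hui⟩ := exists_edge_mem_H hleaf hv
        refine ⟨u, ⟨hu, fun h => by simp [hl] at h⟩, hui, fun u' hu' hui' => ?_⟩
        by_contra hne
        exact Set.disjoint_left.1 (hdec v hl u' u hu'.1 hu hne) hui' hui
    obtain ⟨u, hvu, hui, huniq⟩ := hnext
    obtain ⟨p, hhead, hchain, hmem, w, s, hlast, hw, hwu⟩ := ih u hvu.1 hui (hroot.tail hvu)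
    obtain ⟨p', rfl⟩ : ∃ p', p = u :: p' := by
      cases p with
      | nil => simp at hhead
      | cons x p' => exact ⟨p', by simpa using hhead⟩
    refine ⟨v :: u :: p', rfl, List.IsChain.cons_cons hvu.1 hchain, fun x => ?_, w, s, ?_, hw, ?_⟩
    · rw [List.mem_cons, hmem]
      constructor
      · rintro (rfl | ⟨hx, hxi⟩)
        · exact ⟨.refl, hv⟩
        · exact ⟨hx.head hvu, hxi⟩
      · rintro ⟨hx, hxi⟩
        rcases hx.cases_head with rfl | ⟨u', hu', hx'⟩
        · exact Or.inl rfl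
        · have hui' : u' ∈ D.H i := by
            obtain ⟨y, t, hy, hyl⟩ := hxi
            exact ⟨y, t, (reflTransGen_edge_of_selected hx').trans hy, hyl⟩
          obtain rfl := huniq u' hu' hui'
          exact Or.inr ⟨hx', hxi⟩
    · rw [List.getLast?_cons_cons]
      exact hlast
    · rintro w' hw' s' hs'
      rcases List.mem_cons.1 hw' with rfl | hw'
      · exact (hleaf _ hs').elim
      · exact hwu w' hw' s' hs'

/-- Selecting an input inside a support `A` for each disjunction of `A` yields a certificate. -/
theorem isCertificate_selected [Finite V] (hdec : D.Decomposable) (hsmooth : D.Smooth)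
    {A : Set V} (hA : D.IsSupport A) {c : V → V}
    (hc : ∀ v ∈ A, D.label v = NodeLabel.disj → D.edge v (c v) ∧ c v ∈ A) :
    {v | Relation.ReflTransGen (D.Selected c) D.root v} ⊆ A ∧
      D.IsCertificate {v | Relation.ReflTransGen (D.Selected c) D.root v} := by
  have hsub : {v | Relation.ReflTransGen (D.Selected c) D.root v} ⊆ A := by
    intro v hv
    induction hv with
    | refl => exact hA.root_mem
    | @tail v u _ hvu ih =>
      cases hl : D.label v with
      | leaf d => exact (not_edge_of_leaf hl hvu.1).elim
      | disj => exact hvu.2 hl ▸ (hc v ih hl).2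
      | conj => exact hA.conj v ih hl u hvu.1
  have hpath := fun i => exists_selected_path hdec hsmooth
    (fun v hv hl => (hc v (hsub hv) hl).1) i D.root (mem_H_root i) .refl
  refine ⟨hsub, ⟨.refl, fun v hv hl => ?_, fun v hv hl u hu => ?_⟩, fun v hv hne => ?_,
    fun i => ?_, fun i S hS => ?_⟩
  · have h := (hc v (hsub hv) hl).1
    exact ⟨c v, Relation.ReflTransGen.tail hv ⟨h, fun _ => rfl⟩, h⟩
  · exact Relation.ReflTransGen.tail hv ⟨hu, fun h => by simp [hl] at h⟩
  · rcases Relation.ReflTransGen.cases_tail hv with h | ⟨p, hp, hpv⟩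
    · exact (hne h).elim
    · exact ⟨p, hp, hpv.1⟩
  · obtain ⟨p, -, -, hmem, w, s, hlast, hw, huniq⟩ := hpath i
    exact ⟨w, ((hmem w).1 (List.mem_of_getLast? hlast)).1, s, hw,
      fun w' hw' s' hs' => huniq w' ((hmem w').2 ⟨hw', mem_H_of_leaf hs'⟩) s' hs'⟩
  · obtain ⟨p, hhead, hchain, hmem, w, s, hlast, hw, -⟩ := hpath i
    have := hS.2 p ⟨hchain, fun v hv => ((hmem v).1 hv).2, hhead, w, _, hlast, hw⟩
    refine (existsUnique_congr fun v => ?_).1 this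
    rw [hmem]
    exact ⟨fun h => ⟨h.1.1, h.2⟩, fun h => ⟨⟨h.1, hS.1 v h.2⟩, h.2⟩⟩

theorem exists_certificate [Finite V] (hdec : D.Decomposable) (hsmooth : D.Smooth)
    {A : Set V} (hA : D.IsSupport A) : ∃ T ⊆ A, D.IsCertificate T := by
  have : ∀ v, ∃ u, v ∈ A → D.label v = NodeLabel.disj → D.edge v u ∧ u ∈ A := fun v => by
    by_cases h : v ∈ A ∧ D.label v = NodeLabel.disj
    · obtain ⟨u, hu, hvu⟩ := hA.disj v h.1 h.2
      exact ⟨u, fun _ _ => ⟨hvu, hu⟩⟩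
    · exact ⟨v, fun h1 h2 => (h ⟨h1, h2⟩).elim⟩
  choose c hc using this
  exact ⟨_, isCertificate_selected hdec hsmooth hA hc⟩

/-- If each non-root node of a support `A` has a parent in `A`, then each node of `A` belongs to a
certificate inside `A`: select the inputs along a path in `A` from the root to the node. -/
theorem exists_certificate_mem [Finite V] (hdec : D.Decomposable) (hsmooth : D.Smooth)
    {A : Set V} (hA : D.IsSupport A) (hpar : ∀ v ∈ A, v ≠ D.root → ∃ p ∈ A, D.edge p v)
    {q : V} (hq : q ∈ A) : ∃ T ⊆ A, D.IsCertificate T ∧ q ∈ T := by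
  classical
  suffices h : ∃ c : V → V,
      (∀ v ∈ A, D.label v = NodeLabel.disj → D.edge v (c v) ∧ c v ∈ A) ∧
      Relation.ReflTransGen (D.Selected c) D.root q by
    obtain ⟨c, hc, hcq⟩ := h
    obtain ⟨h1, h2⟩ := isCertificate_selected hdec hsmooth hA hc
    exact ⟨_, h1, h2, hcq⟩
  induction q using D.wellFounded_edge.induction with
  | _ q ih =>
  by_cases hroot : q = D.root
  · subst hroot
    choose! c hcA hce using hA.disj
    exact ⟨c, fun v hv hl => ⟨hce v hv hl, hcA v hv hl⟩, .refl⟩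
  · obtain ⟨p, hpA, hpq⟩ := hpar q hq hroot
    obtain ⟨c, hc, hcp⟩ := ih p hpq hpA
    refine ⟨Function.update c p q, fun v hv hl => ?_, ?_⟩
    · by_cases hvp : v = p
      · subst hvp
        rw [Function.update_self]
        exact ⟨hpq, hq⟩
      · rw [Function.update_of_ne hvp]
        exact hc v hv hl
    · exact Relation.ReflTransGen.tail (reflTransGen_selected_update hcp q)
        ⟨hpq, fun _ => (Function.update_self p q c).symm⟩

end NNF

/-! ### The clauses of a DNNF and their models -/

namespace NNF

section Base

variable {ι : Type*} {dom : ι → Type*} {V W : Type*} {D : NNF dom V} {ν : V → W}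
  {δ : DomVar dom → W}

/-- The nodes whose negation is not in `U`. -/
def alive (ν : V → W) (U : Set (Lit W)) : Set V := {v | Lit.neg (ν v) ∉ U}

theorem mem_alive_of_pos_mem {φ : CNF W} {U : Set (Lit W)} (hU : Closed φ U) {v : V}
    (hv : Lit.pos (ν v) ∈ U) : v ∈ alive ν U := hU.consistent _ hv

/-- An implication clause from `v` to a disjunction propagates deadness from all members of the
disjunction to `v`. -/
theorem exists_alive_of_clause {φ : CNF W} {U : Set (Lit W)} (hU : Closed φ U) {v : V}
    (hv : v ∈ alive ν U) {Q : V → Prop}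
    (hC : {l | l = Lit.neg (ν v) ∨ ∃ u, Q u ∧ l = Lit.pos (ν u)} ∈ φ) :
    ∃ u ∈ alive ν U, Q u := by
  obtain ⟨g, hg, hne, hgU⟩ := hU.exists_other hC (Or.inl rfl) hv
  rcases hg with rfl | ⟨u, hu, rfl⟩
  · exact (hne rfl).elim
  · exact ⟨u, hgU, hu⟩

theorem pos_root_mem {U : Set (Lit W)} (hU : Closed (D.baseClauses ν δ) U) :
    Lit.pos (ν D.root) ∈ U :=
  hU.propagate {Lit.pos (ν D.root)} (Or.inr rfl) _ rfl fun _ hg hne => (hne hg).elim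

theorem isSupport_alive {U : Set (Lit W)} (hU : Closed (D.baseClauses ν δ) U) :
    D.IsSupport (alive ν U) := by
  refine ⟨mem_alive_of_pos_mem hU (pos_root_mem hU), fun v hv hl => ?_, fun v hv hl u hu => ?_⟩
  · exact exists_alive_of_clause hU hv (Or.inl <| Or.inl <| Or.inl <| Or.inl ⟨v, hl, rfl⟩)
  · obtain ⟨g, rfl | rfl, hne, hgU⟩ := hU.exists_other
      (Or.inl <| Or.inl <| Or.inl <| Or.inr ⟨v, u, hl, hu, rfl⟩) (Or.inl rfl) hv
    · exact (hne rfl).elim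
    · exact hgU

theorem exists_parent_alive {U : Set (Lit W)} (hU : Closed (D.baseClauses ν δ) U) {v : V}
    (hv : v ∈ alive ν U) (hne : v ≠ D.root) : ∃ p ∈ alive ν U, D.edge p v := by
  have hp : ∃ p, D.edge p v := by
    rcases (D.reachable v).cases_tail with h | ⟨p, -, hp⟩
    · exact (hne h).elim
    · exact ⟨p, hp⟩
  exact exists_alive_of_clause hU hv (Or.inl <| Or.inl <| Or.inr ⟨v, hp, rfl⟩)

theorem neg_mem_of_no_leaf {U : Set (Lit W)} (hU : Closed (D.baseClauses ν δ) U) {d : DomVar dom}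
    (hd : ∀ v, D.label v ≠ NodeLabel.leaf d) : Lit.neg (δ d) ∈ U :=
  hU.propagate {Lit.neg (δ d)} (Or.inl <| Or.inr ⟨d, hd, rfl⟩) _ rfl
    fun _ hg hne => (hne hg).elim

theorem sat_baseClauses {T : Set V} (hT : D.IsCertificate T) {a : W → Bool}
    (hnode : ∀ v, a (ν v) = true ↔ v ∈ T)
    (hdom : ∀ d, (∀ v, D.label v ≠ NodeLabel.leaf d) → a (δ d) = false) :
    Sat (D.baseClauses ν δ) a := by
  have hneg : ∀ v, v ∉ T → (Lit.neg (ν v)).Holds a := fun v hv => by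
    rw [← hnode] at hv
    simpa [Lit.Holds, Lit.neg] using hv
  have hpos : ∀ v ∈ T, (Lit.pos (ν v)).Holds a := fun v hv => (hnode v).2 hv
  rintro C ((((⟨v, hl, rfl⟩ | ⟨v, u, hl, hu, rfl⟩) | ⟨v, ⟨p, hp⟩, rfl⟩) | ⟨d, hd, rfl⟩) | rfl)
  · by_cases hv : v ∈ T
    · obtain ⟨u, huT, hu⟩ := hT.disj v hv hl
      exact ⟨_, Or.inr ⟨u, hu, rfl⟩, hpos u huT⟩
    · exact ⟨_, Or.inl rfl, hneg v hv⟩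
  · by_cases hv : v ∈ T
    · exact ⟨_, Or.inr rfl, hpos u (hT.conj v hv hl u hu)⟩
    · exact ⟨_, Or.inl rfl, hneg v hv⟩
  · by_cases hv : v ∈ T
    · obtain ⟨p', hpT, hp'⟩ := hT.parent v hv (by rintro rfl; exact not_edge_root hp)
      exact ⟨_, Or.inr ⟨p', hp', rfl⟩, hpos p' hpT⟩
    · exact ⟨_, Or.inl rfl, hneg v hv⟩
  · exact ⟨_, rfl, hdom d hd⟩
  · exact ⟨_, rfl, hpos _ hT.root_mem⟩

theorem eval_root_of_sat [Finite V] {a : W → Bool} (ha : Sat (D.baseClauses ν δ) a)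
    {P : DomVar dom → Prop} (hleaf : ∀ v d, D.label v = NodeLabel.leaf d → a (ν v) = true → P d) :
    D.Eval P D.root := by
  suffices h : ∀ v, a (ν v) = true → D.Eval P v by
    obtain ⟨l, rfl, hl⟩ := ha {Lit.pos (ν D.root)} (Or.inr rfl)
    exact h _ hl
  intro v
  induction v using D.wellFounded_input.induction with
  | _ v ih =>
  intro hv
  have hnv : ¬ (Lit.neg (ν v)).Holds a := by simp [Lit.Holds, Lit.neg, hv]
  cases hl : D.label v with
  | leaf d => exact .leaf hl (hleaf v d hl hv)
  | disj =>
    obtain ⟨l, rfl | ⟨u, hu, rfl⟩, hla⟩ :=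
      ha _ (Or.inl <| Or.inl <| Or.inl <| Or.inl ⟨v, hl, rfl⟩)
    · exact (hnv hla).elim
    · exact .disj hl hu (ih u hu hla)
  | conj =>
    refine .conj hl fun u hu => ?_
    obtain ⟨l, rfl | rfl, hla⟩ :=
      ha _ (Or.inl <| Or.inl <| Or.inl <| Or.inr ⟨v, u, hl, hu, rfl⟩)
    · exact (hnv hla).elim
    · exact ih u hu hla

theorem isSupport_eval {P : DomVar dom → Prop} (h : D.Eval P D.root) :
    D.IsSupport {v | D.Eval P v} := by
  refine ⟨h, fun v hv hl => ?_, fun v hv hl u hu => ?_⟩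
  · cases hv with
    | leaf hv' => simp [hl] at hv'
    | conj hv' => simp [hl] at hv'
    | disj _ hu h' => exact ⟨_, h', hu⟩
  · cases hv with
    | leaf hv' => simp [hl] at hv'
    | conj _ h' => exact h' u hu
    | disj hv' => simp [hl] at hv'

/-- A certificate inside the alive nodes contains all nodes in `U`, if a node in `U` makes the
other nodes of its separators dead. -/
theorem mem_certificate_of_pos_mem [Finite V] {𝒮 : ι → Set (Finset V)}
    (hcover : D.IsSeparatorCover 𝒮) {U : Set (Lit W)}
    (hamo : ∀ S : Sep 𝒮, ∀ p ∈ S.1, ∀ q ∈ S.1, p ≠ q → Lit.pos (ν p) ∈ U → q ∉ alive ν U)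
    {T : Set V} (hT : D.IsCertificate T) (hTU : T ⊆ alive ν U) {p : V}
    (hp : Lit.pos (ν p) ∈ U) : p ∈ T := by
  by_cases hroot : p = D.root
  · exact hroot ▸ hT.root_mem
  · obtain ⟨i, hi⟩ := exists_mem_H (D := D) p
    obtain ⟨S, hS, hpS⟩ : p ∈ {v | ∃ S ∈ 𝒮 i, v ∈ S} := by
      rw [(hcover i).2]
      exact ⟨hi, hroot⟩
    obtain ⟨v, ⟨hvT, hvS⟩, -⟩ := hT.separator i S ((hcover i).1 S hS)
    by_contra hpT
    exact hamo ⟨S, i, hS⟩ p hpS v hvS (by rintro rfl; exact hpT hvT) hp (hTU hvT)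

end Base

end NNF

/-! ### Substituting Boolean variables for the domain variables -/

theorem boolLit_commutesCompl {ι Y : Type*} :
    Lit.CommutesCompl (boolLit : Lit (DomVar (fun _ : ι => Bool) ⊕ Y) → Lit (ι ⊕ Y)) := by
  rintro ⟨⟨i, b⟩ | y, s⟩
  · cases b <;> cases s <;> rfl
  · rfl

/-- The assignment of the domain variables given by an assignment of the Boolean variables. -/
def pullback {ι Y : Type*} (a : ι ⊕ Y → Bool) : DomVar (fun _ : ι => Bool) ⊕ Y → Bool
  | Sum.inl ⟨i, s⟩ => a (Sum.inl i) == s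
  | Sum.inr y => a (Sum.inr y)

theorem holds_boolLit {ι Y : Type*} (a : ι ⊕ Y → Bool)
    (l : Lit (DomVar (fun _ : ι => Bool) ⊕ Y)) : (boolLit l).Holds a ↔ l.Holds (pullback a) := by
  obtain ⟨⟨i, b⟩ | y, s⟩ := l
  · simp only [Lit.Holds, boolLit, pullback]
    cases b <;> cases s <;> simp
  · rfl

theorem sat_boolSubst {ι Y : Type*} {ψ : CNF (DomVar (fun _ : ι => Bool) ⊕ Y)}
    {a : ι ⊕ Y → Bool} : Sat (boolSubst ψ) a ↔ Sat ψ (pullback a) :=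
  sat_mapLit (holds_boolLit a)

namespace NNF

variable {ι V Y : Type*} {D : NNF (fun _ : ι => Bool) V}

variable (D) in
/-- The variables `ν v` of the nodes: a leaf has its domain variable, and an inner node `v` has a
variable `y v` of its own. -/
structure IsNumbering (ν : V → DomVar (fun _ : ι => Bool) ⊕ Y) (y : D.Inner → Y) : Prop where
  leaf : ∀ v d, D.label v = NodeLabel.leaf d → ν v = Sum.inl d
  inner : ∀ v : D.Inner, ν v = Sum.inr (y v)

open Classical in
variable (D) in
/-- The assignment of the Boolean variables given by a set `T` of nodes, extended by `b`. -/
noncomputable def assignment (T : Set V) (b : Y → Bool) : ι ⊕ Y → Bool :=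
  Sum.elim (fun i => decide (∃ v ∈ T, D.label v = NodeLabel.leaf ⟨i, true⟩)) b

theorem assignment_eq_of_leaf {T : Set V} (hT : D.IsCertificate T) (b : Y → Bool) {i : ι}
    {s : Bool} {v : V} (hv : v ∈ T) (hl : D.label v = NodeLabel.leaf ⟨i, s⟩) :
    D.assignment T b (Sum.inl i) = s := by
  obtain ⟨w, -, t, -, huniq⟩ := hT.leaf i
  simp only [assignment, Sum.elim_inl]
  cases s
  · rw [decide_eq_false_iff_not]
    rintro ⟨v', hv', hl'⟩
    rw [huniq v' hv' _ hl', ← huniq v hv _ hl, hl] at hl'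
    simp at hl'
  · simpa using ⟨v, hv, hl⟩

theorem pullback_assignment_leaf {T : Set V} (hT : D.IsCertificate T) (b : Y → Bool)
    (d : DomVar fun _ : ι => Bool) :
    pullback (D.assignment T b) (Sum.inl d) = true ↔ ∃ v ∈ T, D.label v = NodeLabel.leaf d := by
  obtain ⟨i, s⟩ := d
  obtain ⟨w, hw, t, hl, -⟩ := hT.leaf i
  simp only [pullback, assignment_eq_of_leaf hT b hw hl, beq_iff_eq]
  constructor
  · rintro rfl
    exact ⟨w, hw, hl⟩
  · rintro ⟨v, hv, hlv⟩
    rw [← assignment_eq_of_leaf hT b hw hl, assignment_eq_of_leaf hT b hv hlv]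

theorem pullback_assignment_node {ν : V → DomVar (fun _ : ι => Bool) ⊕ Y} {y : D.Inner → Y}
    (hν : D.IsNumbering ν y) {T : Set V} (hT : D.IsCertificate T) {b : Y → Bool}
    (hb : ∀ v : D.Inner, b (y v) = true ↔ v.1 ∈ T) (v : V) :
    pullback (D.assignment T b) (ν v) = true ↔ v ∈ T := by
  by_cases h : ∃ d, D.label v = NodeLabel.leaf d
  · obtain ⟨d, hd⟩ := h
    rw [hν.leaf v d hd, pullback_assignment_leaf hT]
    constructor
    · rintro ⟨w, hw, hl⟩
      rwa [D.leaf_unique v w d hd hl]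
    · exact fun hv => ⟨v, hv, hd⟩
  · push Not at h
    rw [hν.inner ⟨v, h⟩]
    exact hb ⟨v, h⟩

/-- The values `b` on the variables that do not come from domain variables extend the certificate
`T` to a model of the base clauses and of the formula `Θ`. -/
structure Extends (ν : V → DomVar (fun _ : ι => Bool) ⊕ Y) (y : D.Inner → Y)
    (Θ : CNF (DomVar (fun _ : ι => Bool) ⊕ Y)) (T : Set V) (b : Y → Bool) : Prop where
  inner : ∀ v : D.Inner, b (y v) = true ↔ v.1 ∈ T
  sat : Sat Θ (pullback (D.assignment T b))

theorem Extends.sat_boolSubst {ν : V → DomVar (fun _ : ι => Bool) ⊕ Y} {y : D.Inner → Y}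
    (hν : D.IsNumbering ν y) {Θ : CNF (DomVar (fun _ : ι => Bool) ⊕ Y)} {T : Set V}
    (hT : D.IsCertificate T) {b : Y → Bool} (h : Extends ν y Θ T b) :
    Sat (boolSubst (D.baseClauses ν Sum.inl ∪ Θ)) (D.assignment T b) := by
  rw [DNNFEnc.sat_boolSubst, sat_union]
  refine ⟨sat_baseClauses hT (pullback_assignment_node hν hT h.inner) fun d hd => ?_, h.sat⟩
  by_contra hne
  rw [Bool.not_eq_false, pullback_assignment_leaf hT] at hne
  obtain ⟨v, -, hv⟩ := hne
  exact hd v hv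

theorem isEncoding_boolSubst [Finite V] (hdec : D.Decomposable) (hsmooth : D.Smooth)
    {f : (ι → Bool) → Prop} (hf : D.Represents f)
    {ν : V → DomVar (fun _ : ι => Bool) ⊕ Y} {y : D.Inner → Y}
    (hν : D.IsNumbering ν y) {Θ : CNF (DomVar (fun _ : ι => Bool) ⊕ Y)}
    (hext : ∀ T, D.IsCertificate T → ∃ b, Extends ν y Θ T b) :
    IsEncoding f (boolSubst (D.baseClauses ν Sum.inl ∪ Θ)) := by
  intro a
  rw [hf]
  constructor
  · intro h
    obtain ⟨T, hTE, hT⟩ := exists_certificate hdec hsmooth (isSupport_eval h)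
    obtain ⟨b, hb⟩ := hext T hT
    refine ⟨b, ?_⟩
    convert hb.sat_boolSubst hν hT
    funext w
    rcases w with i | z
    · obtain ⟨w, hw, t, hl, -⟩ := hT.leaf i
      rw [assignment_eq_of_leaf hT b hw hl]
      cases hTE hw with
      | leaf hv ha =>
        rw [hl] at hv
        cases hv
        exact ha
      | conj hv => simp [hl] at hv
      | disj hv => simp [hl] at hv
    · rfl
  · rintro ⟨b, hb⟩
    rw [DNNFEnc.sat_boolSubst, sat_union] at hb
    refine eval_root_of_sat hb.1 fun v d hl hv => ?_
    rw [hν.leaf v d hl] at hv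
    simpa [pullback] using hv

/-- The values `b` respect the literals of `U` on the auxiliary variables, that is, on the variables
that belong to no node. -/
def Respects (y : D.Inner → Y) (U : Set (Lit (DomVar (fun _ : ι => Bool) ⊕ Y)))
    (b : Y → Bool) : Prop :=
  ∀ z, z ∉ Set.range y → ∀ s, (⟨Sum.inr z, s⟩ : Lit _) ∈ U → b z = s

/-- A certificate inside the alive nodes that contains the nodes in `U` yields a model of `U`. -/
theorem Extends.holds_of_mem {ν : V → DomVar (fun _ : ι => Bool) ⊕ Y} {y : D.Inner → Y}
    (hν : D.IsNumbering ν y) {Θ : CNF (DomVar (fun _ : ι => Bool) ⊕ Y)}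
    {U : Set (Lit (ι ⊕ Y))} (hU : Closed (D.baseClauses ν Sum.inl) (boolLit ⁻¹' U)) {T : Set V}
    (hT : D.IsCertificate T) (hTU : T ⊆ alive ν (boolLit ⁻¹' U))
    (hpos : ∀ p, Lit.pos (ν p) ∈ boolLit ⁻¹' U → p ∈ T)
    {b : Y → Bool} (h : Extends ν y Θ T b) (hb : Respects y (boolLit ⁻¹' U) b)
    {g : Lit (ι ⊕ Y)} (hg : g ∈ U) : g.Holds (D.assignment T b) := by
  obtain ⟨i | z, s⟩ := g
  · have hm : Lit.pos (Sum.inl ⟨i, s⟩) ∈ boolLit ⁻¹' U := by simpa [boolLit, Lit.pos] using hg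
    by_cases hleaf : ∃ v, D.label v = NodeLabel.leaf ⟨i, s⟩
    · obtain ⟨v, hv⟩ := hleaf
      rw [← hν.leaf v _ hv] at hm
      exact assignment_eq_of_leaf hT b (hpos v hm) hv
    · push Not at hleaf
      exact (hU.consistent _ hm (neg_mem_of_no_leaf hU hleaf)).elim
  · change b z = s
    by_cases hz : z ∈ Set.range y
    · obtain ⟨v, rfl⟩ := hz
      have hvar := hν.inner v
      cases s
      · have hdead : v.1 ∉ alive ν (boolLit ⁻¹' U) := fun hv => hv (by rw [hvar]; exact hg)
        rw [← Bool.not_eq_true, h.inner]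
        exact fun hv => hdead (hTU hv)
      · exact (h.inner v).2 (hpos _ (by rw [hvar]; exact hg))
    · exact hb z hz s hg

section Completeness

variable [Finite V] [Finite ι] [Finite Y] (hdec : D.Decomposable) (hsmooth : D.Smooth)
  {𝒮 : ι → Set (Finset V)} (hcover : D.IsSeparatorCover 𝒮)
  {ν : V → DomVar (fun _ : ι => Bool) ⊕ Y} {y : D.Inner → Y}
  (hν : D.IsNumbering ν y) {Θ : CNF (DomVar (fun _ : ι => Bool) ⊕ Y)}
  (hamo : ∀ U, Closed Θ U → ∀ S : Sep 𝒮, ∀ p ∈ S.1, ∀ q ∈ S.1, p ≠ q →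
    Lit.pos (ν p) ∈ U → q ∉ alive ν U)
  (hext : ∀ U, Closed Θ U → ∀ T, D.IsCertificate T → T ⊆ alive ν U →
    ∃ b, Extends ν y Θ T b ∧ Respects y U b)

include hdec hsmooth hcover hν hamo hext

theorem urcOn_boolSubst : URCOn (boolSubst (D.baseClauses ν Sum.inl ∪ Θ)) Set.univ := by
  refine urcOn_univ_of_exists_model fun U hU => ?_
  have hcl := hU.preimage boolLit_commutesCompl
  have hbase := hcl.mono Set.subset_union_left
  have hΘ := hcl.mono Set.subset_union_right
  obtain ⟨T, hTU, hT⟩ := exists_certificate hdec hsmooth (isSupport_alive hbase)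
  obtain ⟨b, hb, hres⟩ := hext _ hΘ T hT hTU
  exact ⟨_, hb.sat_boolSubst hν hT, fun g hg => hb.holds_of_mem hν hbase hT hTU
    (fun p hp => mem_certificate_of_pos_mem hcover (hamo _ hΘ) hT hTU hp) hres hg⟩

/-- Propagation completeness follows if, moreover, the literal of a node is propagated once the
other nodes of a separator are dead, and a literal on an auxiliary variable that is not propagated
can be falsified together with any certificate through a suitable alive node. -/
theorem pcOn_boolSubst
    (heo : ∀ U, Closed Θ U → ∀ S : Sep 𝒮, ∀ v ∈ S.1, Lit.pos (ν v) ∉ U →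
      ∃ u ∈ S.1, u ≠ v ∧ u ∈ alive ν U)
    (haux : ∀ U, Closed Θ U → ∀ z, z ∉ Set.range y → ∀ s, (⟨Sum.inr z, s⟩ : Lit _) ∉ U →
      ∃ q ∈ alive ν U, ∀ T, D.IsCertificate T → T ⊆ alive ν U → q ∈ T →
        ∃ b, Extends ν y Θ T b ∧ Respects y U b ∧ b z ≠ s) :
    PCOn (boolSubst (D.baseClauses ν Sum.inl ∪ Θ)) Set.univ := by
  refine pcOn_univ_of_exists_model fun U hU l hl => ?_
  have hcl := hU.preimage boolLit_commutesCompl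
  have hbase := hcl.mono Set.subset_union_left
  have hΘ := hcl.mono Set.subset_union_right
  have through : ∀ q ∈ alive ν (boolLit ⁻¹' U), ∃ T ⊆ alive ν (boolLit ⁻¹' U),
      D.IsCertificate T ∧ q ∈ T := fun q hq =>
    exists_certificate_mem hdec hsmooth (isSupport_alive hbase)
      (fun v hv hne => exists_parent_alive hbase hv hne) hq
  have model : ∀ T b, D.IsCertificate T → T ⊆ alive ν (boolLit ⁻¹' U) → Extends ν y Θ T b →
      Respects y (boolLit ⁻¹' U) b → ¬ l.Holds (D.assignment T b) →
      ∃ a, Sat (boolSubst (D.baseClauses ν Sum.inl ∪ Θ)) a ∧ (∀ g ∈ U, g.Holds a) ∧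
        ¬ l.Holds a := fun T b hT hTU hb hres hlb =>
    ⟨_, hb.sat_boolSubst hν hT, fun g hg => hb.holds_of_mem hν hbase hT hTU
      (fun p hp => mem_certificate_of_pos_mem hcover (hamo _ hΘ) hT hTU hp) hres hg, hlb⟩
  obtain ⟨i | z, s⟩ := l
  · -- the literal is falsified by the complementary leaf of `x_i`
    have hm : Lit.neg (Sum.inl ⟨i, !s⟩) ∉ boolLit ⁻¹' U := by simpa [boolLit, Lit.neg] using hl
    by_cases hleaf : ∃ v, D.label v = NodeLabel.leaf ⟨i, !s⟩
    · obtain ⟨v, hv⟩ := hleaf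
      rw [← hν.leaf v _ hv] at hm
      obtain ⟨T, hTU, hT, hvT⟩ := through v hm
      obtain ⟨b, hb, hres⟩ := hext _ hΘ T hT hTU
      refine model T b hT hTU hb hres ?_
      rw [Lit.Holds, assignment_eq_of_leaf hT b hvT hv]
      simp
    · push Not at hleaf
      exact (hm (neg_mem_of_no_leaf hbase hleaf)).elim
  · by_cases hz : z ∈ Set.range y
    · obtain ⟨v, rfl⟩ := hz
      have hvar := hν.inner v
      cases s
      · obtain ⟨T, hTU, hT, hvT⟩ := through v.1 (fun hv => hl (by rw [hvar] at hv; exact hv))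
        obtain ⟨b, hb, hres⟩ := hext _ hΘ T hT hTU
        refine model T b hT hTU hb hres fun hlb => ?_
        exact Bool.false_ne_true (Eq.trans (Eq.symm hlb) ((hb.inner v).2 hvT))
      · -- a certificate through another node of a separator of `v` avoids `v`
        have hvU : Lit.pos (ν v.1) ∉ boolLit ⁻¹' U := fun hv => hl (by rw [hvar] at hv; exact hv)
        obtain ⟨i, hi⟩ := exists_mem_H (D := D) v.1
        obtain ⟨S, hS, hvS⟩ : v.1 ∈ {v | ∃ S ∈ 𝒮 i, v ∈ S} := by
          rw [(hcover i).2]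
          refine ⟨hi, fun hroot => hvU ?_⟩
          rw [Set.mem_singleton_iff.1 hroot]
          exact pos_root_mem hbase
        obtain ⟨u, huS, hne, hu⟩ := heo _ hΘ ⟨S, i, hS⟩ v.1 hvS hvU
        obtain ⟨T, hTU, hT, huT⟩ := through u hu
        obtain ⟨b, hb, hres⟩ := hext _ hΘ T hT hTU
        refine model T b hT hTU hb hres fun hlb => hne ?_
        exact (hT.separator i S ((hcover i).1 S hS)).unique ⟨huT, huS⟩
          ⟨(hb.inner v).1 hlb, hvS⟩
    · obtain ⟨q, hq, hqT⟩ := haux _ hΘ z hz s hl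
      obtain ⟨T, hTU, hT, hqT'⟩ := through q hq
      obtain ⟨b, hb, hres, hbz⟩ := hqT T hT hTU hqT'
      exact model T b hT hTU hb hres hbz

end Completeness

/-! ### The encodings with the direct representations -/

theorem isNumbering_nodeVar {ι V : Type*} (D : NNF (fun _ : ι => Bool) V) :
    D.IsNumbering D.nodeVar id := by
  refine ⟨fun v d hd => ?_, fun v => ?_⟩
  · have h : ∃ d, D.label v = NodeLabel.leaf d := ⟨d, hd⟩
    have e : d = h.choose := NodeLabel.leaf.inj (hd.symm.trans h.choose_spec)
    rw [nodeVar, dif_pos h, ← e]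
  · exact dif_neg fun ⟨d, hd⟩ => v.2 d hd

theorem isNumbering_nodeVar' {ι V : Type*} (D : NNF (fun _ : ι => Bool) V)
    {𝒮 : ι → Set (Finset V)} (Z : Sep 𝒮 → Type*) : D.IsNumbering (D.nodeVar' Z) Sum.inl :=
  ⟨fun v d hd => by rw [nodeVar', (isNumbering_nodeVar D).leaf v d hd]; rfl,
    fun v => by rw [nodeVar', (isNumbering_nodeVar D).inner v]; rfl⟩

theorem IsCertificate.existsUnique_sep {ι : Type*} {dom : ι → Type*} {V : Type*} {D : NNF dom V}
    {𝒮 : ι → Set (Finset V)} (hcover : D.IsSeparatorCover 𝒮) {T : Set V}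
    (hT : D.IsCertificate T) (S : Sep 𝒮) : ∃! v, v ∈ T ∧ v ∈ S.1 := by
  obtain ⟨S, i, hS⟩ := S
  exact hT.separator i S ((hcover i).1 S hS)

theorem closed_amoRep_dead {V W : Type*} {ν : V → W} {S : Finset V} {U : Set (Lit W)}
    (hU : Closed (amoRep ν S) U) {p q : V} (hp : p ∈ S) (hq : q ∈ S) (hne : p ≠ q)
    (hpU : Lit.pos (ν p) ∈ U) : q ∉ alive ν U := by
  intro hqU
  obtain ⟨g, rfl | rfl, hg, hgU⟩ := hU.exists_other ⟨q, hq, p, hp, hne.symm, rfl⟩ (Or.inl rfl) hqU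
  · exact hg rfl
  · exact hgU hpU

theorem closed_eoRep_alive {V W : Type*} {ν : V → W} {S : Finset V} {U : Set (Lit W)}
    (hU : Closed (eoRep ν S) U) {v : V} (hv : v ∈ S) (hvU : Lit.pos (ν v) ∉ U) :
    ∃ u ∈ S, u ≠ v ∧ u ∈ alive ν U := by
  obtain ⟨g, ⟨u, hu, rfl⟩, hg, hgU⟩ := hU.exists_other (Or.inr rfl) ⟨v, hv, rfl⟩ hvU
  exact ⟨u, hu, by rintro rfl; exact hg rfl, hgU⟩

theorem sat_eoRep {V W : Type*} {ν : V → W} {S : Finset V} {T : Set V} {a : W → Bool}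
    (hnode : ∀ v, a (ν v) = true ↔ v ∈ T) (hT : ∃! v, v ∈ T ∧ v ∈ S) :
    Sat (eoRep ν S) a := by
  rintro C (⟨u, hu, v, hv, hne, rfl⟩ | rfl)
  · have hneg : ∀ w, w ∉ T → (Lit.neg (ν w)).Holds a := fun w hw => by
      rw [← hnode] at hw
      simpa [Lit.Holds, Lit.neg] using hw
    by_cases huT : u ∈ T
    · exact ⟨_, Or.inr rfl, hneg v fun hvT => hne (hT.unique ⟨huT, hu⟩ ⟨hvT, hv⟩)⟩
    · exact ⟨_, Or.inl rfl, hneg u huT⟩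
  · obtain ⟨v, ⟨hvT, hvS⟩, -⟩ := hT
    exact ⟨_, ⟨v, hvS, rfl⟩, (hnode v).2 hvT⟩

section Direct

variable {ι V : Type*} {D : NNF (fun _ : ι => Bool) V} {𝒮 : ι → Set (Finset V)}

theorem exists_extends_eoRep (hcover : D.IsSeparatorCover 𝒮) {T : Set V}
    (hT : D.IsCertificate T) :
    ∃ b, Extends D.nodeVar id (⋃ S : Sep 𝒮, eoRep D.nodeVar S.1) T b := by
  classical
  refine ⟨fun v => decide (v.1 ∈ T), fun v => by simp, ?_⟩
  intro C hC
  obtain ⟨S, hS⟩ := Set.mem_iUnion.1 hC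
  exact sat_eoRep (pullback_assignment_node (isNumbering_nodeVar D) hT fun v => by simp)
    (hT.existsUnique_sep hcover S) C hS

theorem respects_id (U : Set (Lit (DomVar (fun _ : ι => Bool) ⊕ D.Inner))) (b : D.Inner → Bool) :
    Respects id U b := fun z hz => (hz ⟨z, rfl⟩).elim

variable [Finite V] [Finite ι] (hdec : D.Decomposable) (hsmooth : D.Smooth)
  (hcover : D.IsSeparatorCover 𝒮) {f : (ι → Bool) → Prop} (hf : D.Represents f)

include hdec hsmooth hcover hf

theorem isURCEncoding_psiC : IsURCEncoding f (boolSubst (D.psiC 𝒮)) := by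
  have hext : ∀ T, D.IsCertificate T →
      ∃ b, Extends D.nodeVar id (⋃ S : Sep 𝒮, amoRep D.nodeVar S.1) T b := fun T hT => by
    obtain ⟨b, hb⟩ := exists_extends_eoRep hcover hT
    exact ⟨b, hb.inner, fun C hC =>
      hb.sat C (Set.iUnion_mono (fun S => Set.subset_union_left) hC)⟩
  refine ⟨isEncoding_boolSubst hdec hsmooth hf (isNumbering_nodeVar D) hext,
    urcOn_boolSubst hdec hsmooth hcover (isNumbering_nodeVar D) ?_ ?_⟩
  · intro U hU S p hp q hq hne hpU
    exact closed_amoRep_dead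
      (hU.mono (Set.subset_iUnion (fun S : Sep 𝒮 => amoRep D.nodeVar S.1) S)) hp hq hne hpU
  · intro U _ T hT _
    obtain ⟨b, hb⟩ := hext T hT
    exact ⟨b, hb, respects_id U b⟩

theorem isPCEncoding_psiP : IsPCEncoding f (boolSubst (D.psiP 𝒮)) := by
  have hS : ∀ U, Closed (⋃ S : Sep 𝒮, eoRep D.nodeVar S.1) U → ∀ S : Sep 𝒮,
      Closed (eoRep D.nodeVar S.1) U := fun U hU S =>
    hU.mono (Set.subset_iUnion (fun S : Sep 𝒮 => eoRep D.nodeVar S.1) S)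
  refine ⟨isEncoding_boolSubst hdec hsmooth hf (isNumbering_nodeVar D)
    fun T hT => exists_extends_eoRep hcover hT,
    pcOn_boolSubst hdec hsmooth hcover (isNumbering_nodeVar D) ?_ ?_ ?_ ?_⟩
  · intro U hU S p hp q hq hne hpU
    exact closed_amoRep_dead ((hS U hU S).mono Set.subset_union_left) hp hq hne hpU
  · intro U _ T hT _
    obtain ⟨b, hb⟩ := exists_extends_eoRep hcover hT
    exact ⟨b, hb, respects_id U b⟩
  · intro U hU S v hv hvU
    exact closed_eoRep_alive (hS U hU S) hv hvU
  · intro U _ z hz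
    exact (hz ⟨z, rfl⟩).elim

end Direct

/-! ### The encodings with auxiliary variables -/

section Auxiliary

/-- If `θ` is a propagation complete encoding of a constraint `P` that implies at-most-one and is
implied by exactly-one, and `¬q` is not propagated, then `q` alone can be set to true. -/
theorem exists_aux_of_alive {X Z : Type*} {P : (X → Bool) → Prop} {θ : CNF (X ⊕ Z)}
    (hθ : IsPCEncoding P θ) (hamo : ∀ p, P p → AtMostOne p) {U : Set (Lit (X ⊕ Z))}
    (hU : Closed θ U) {q : X} (hq : Lit.neg (Sum.inl q) ∉ U) {p : X → Bool}
    (hp : ∀ v, p v = true ↔ v = q) :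
    ∃ β : Z → Bool, Sat θ (Sum.elim p β) ∧
      ∀ z s, (⟨Sum.inr z, s⟩ : Lit (X ⊕ Z)) ∈ U → β z = s := by
  obtain ⟨a, ha, haU, haq⟩ := PCOn.exists_model hθ.2 hU hq
  have haq : a (Sum.inl q) = true := by simpa [Lit.Holds, Lit.neg] using haq
  have hP : P fun v => a (Sum.inl v) := (hθ.1 _).2 ⟨fun z => a (Sum.inr z), by
    convert ha using 1
    exact Sum.elim_comp_inl_inr a⟩
  refine ⟨fun z => a (Sum.inr z), ?_, fun z s hz => haU _ hz⟩
  convert ha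
  funext w
  rcases w with v | z
  · rw [Sum.elim_inl, Bool.eq_iff_iff, hp]
    exact ⟨fun h => h ▸ haq, fun h => hamo _ hP _ _ h haq⟩
  · rfl

variable {ι V : Type*} {D : NNF (fun _ : ι => Bool) V} {𝒮 : ι → Set (Finset V)}
  {Z : Sep 𝒮 → Type*}

variable (D) in
/-- The variable of the whole encoding that replaces a variable of `θ S`. -/
noncomputable def sepVar (S : Sep 𝒮) :
    S.1 ⊕ Z S → DomVar (fun _ : ι => Bool) ⊕ (D.Inner ⊕ (Σ S, Z S)) :=
  Sum.elim (fun v : S.1 => D.nodeVar' Z v.1) fun z => Sum.inr (Sum.inr ⟨S, z⟩)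

variable (D) in
/-- The conjunction of the formulas of all separators. -/
def sepFormulas (θ : ∀ S : Sep 𝒮, CNF (S.1 ⊕ Z S)) :
    CNF (DomVar (fun _ : ι => Bool) ⊕ (D.Inner ⊕ (Σ S, Z S))) :=
  ⋃ S : Sep 𝒮, rename (D.sepVar S) (θ S)

theorem psiPrime_eq (θ : ∀ S : Sep 𝒮, CNF (S.1 ⊕ Z S)) :
    D.psiPrime Z θ = D.baseClauses (D.nodeVar' Z) Sum.inl ∪ D.sepFormulas θ := rfl

variable (D) in
/-- The literals of the whole encoding that belong to `U`, as literals on the variables of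
`θ S`. -/
def sepLits (U : Set (Lit (DomVar (fun _ : ι => Bool) ⊕ (D.Inner ⊕ (Σ S, Z S)))))
    (S : Sep 𝒮) : Set (Lit (S.1 ⊕ Z S)) :=
  {l | (⟨D.sepVar S l.var, l.sign⟩ : Lit _) ∈ U}

theorem closed_sepLits {θ : ∀ S : Sep 𝒮, CNF (S.1 ⊕ Z S)}
    {U : Set (Lit (DomVar (fun _ : ι => Bool) ⊕ (D.Inner ⊕ (Σ S, Z S))))}
    (hU : Closed (D.sepFormulas θ) U) (S : Sep 𝒮) : Closed (θ S) (D.sepLits U S) :=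
  Closed.preimage (σ := fun l => ⟨D.sepVar S l.var, l.sign⟩) (fun _ => rfl)
    (hU.mono (Set.subset_iUnion (fun S : Sep 𝒮 => rename (D.sepVar S) (θ S)) S))

open Classical in
/-- Values of the auxiliary variables that suit a certificate for each separator on its own
combine to an extension of the certificate. -/
theorem extends_sepFormulas {θ : ∀ S : Sep 𝒮, CNF (S.1 ⊕ Z S)} {T : Set V}
    (hT : D.IsCertificate T) (β : ∀ S, Z S → Bool)
    (hβ : ∀ S : Sep 𝒮, Sat (θ S) (Sum.elim (fun v : S.1 => decide (v.1 ∈ T)) (β S))) :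
    Extends (D.nodeVar' Z) Sum.inl (D.sepFormulas θ) T
      (Sum.elim (fun v : D.Inner => decide (v.1 ∈ T)) fun z => β z.1 z.2) := by
  refine ⟨fun v => by simp, fun C hC => ?_⟩
  obtain ⟨S, hS⟩ := Set.mem_iUnion.1 hC
  refine (sat_mapLit (a := Sum.elim (fun v : S.1 => decide (v.1 ∈ T)) (β S)) ?_).2 (hβ S) C hS
  rintro ⟨v | z, s⟩
  · have h := pullback_assignment_node (isNumbering_nodeVar' D Z) hT
      (b := Sum.elim (fun v : D.Inner => decide (v.1 ∈ T)) fun z => β z.1 z.2)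
      (fun v => by simp) v.1
    have e : pullback (D.assignment T
        (Sum.elim (fun v : D.Inner => decide (v.1 ∈ T)) fun z => β z.1 z.2))
        (D.nodeVar' Z v.1) = decide (v.1 ∈ T) := by
      rw [Bool.eq_iff_iff, h, decide_eq_true_iff]
    simp only [Lit.Holds, sepVar, Sum.elim_inl, e]
  · rfl

theorem respects_sepFormulas {U : Set (Lit (DomVar (fun _ : ι => Bool) ⊕ (D.Inner ⊕ (Σ S, Z S))))}
    {β : ∀ S, Z S → Bool}
    (hβ : ∀ S z s, (⟨Sum.inr z, s⟩ : Lit (S.1 ⊕ Z S)) ∈ D.sepLits U S → β S z = s)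
    (c : D.Inner → Bool) : Respects Sum.inl U (Sum.elim c fun z => β z.1 z.2) := by
  rintro (v | ⟨S, z⟩) hz s hs
  · exact (hz ⟨v, rfl⟩).elim
  · exact hβ S z s hs

section PC

variable {P : ∀ S : Sep 𝒮, (S.1 → Bool) → Prop} {θ : ∀ S : Sep 𝒮, CNF (S.1 ⊕ Z S)}
  (hcover : D.IsSeparatorCover 𝒮) (hθ : ∀ S, IsPCEncoding (P S) (θ S))

include hcover hθ

theorem exists_extends_sepFormulas (heo : ∀ S p, ExactlyOne p → P S p) {T : Set V}
    (hT : D.IsCertificate T) : ∃ b, Extends (D.nodeVar' Z) Sum.inl (D.sepFormulas θ) T b := by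
  classical
  have hone : ∀ S : Sep 𝒮, ExactlyOne fun v : S.1 => decide (v.1 ∈ T) := fun S => by
    obtain ⟨v, ⟨hvT, hvS⟩, huniq⟩ := hT.existsUnique_sep hcover S
    exact ⟨⟨v, hvS⟩, by simpa using hvT,
      fun u hu => Subtype.ext (huniq u.1 ⟨by simpa using hu, u.2⟩)⟩
  choose β hβ using fun S => ((hθ S).1 _).1 (heo S _ (hone S))
  exact ⟨_, extends_sepFormulas hT β hβ⟩

variable (hamo : ∀ S p, P S p → AtMostOne p)
  {U : Set (Lit (DomVar (fun _ : ι => Bool) ⊕ (D.Inner ⊕ (Σ S, Z S))))}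
  (hU : Closed (D.sepFormulas θ) U)

include hamo hU

open Classical in
theorem exists_aux_of_certificate {T : Set V} (hT : D.IsCertificate T)
    (hTU : T ⊆ alive (D.nodeVar' Z) U) (S : Sep 𝒮) :
    ∃ β : Z S → Bool, Sat (θ S) (Sum.elim (fun v : S.1 => decide (v.1 ∈ T)) β) ∧
      ∀ z s, (⟨Sum.inr z, s⟩ : Lit (S.1 ⊕ Z S)) ∈ D.sepLits U S → β z = s := by
  obtain ⟨q, ⟨hqT, hqS⟩, huniq⟩ := hT.existsUnique_sep hcover S
  refine exists_aux_of_alive (hθ S) (hamo S) (closed_sepLits hU S) (q := ⟨q, hqS⟩) (hTU hqT)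
    fun v => ?_
  rw [decide_eq_true_iff]
  exact ⟨fun hv => Subtype.ext (huniq v.1 ⟨hv, v.2⟩), fun hv => hv ▸ hqT⟩

theorem exists_extends_respects {T : Set V} (hT : D.IsCertificate T)
    (hTU : T ⊆ alive (D.nodeVar' Z) U) :
    ∃ b, Extends (D.nodeVar' Z) Sum.inl (D.sepFormulas θ) T b ∧ Respects Sum.inl U b := by
  choose β hβ hβU using exists_aux_of_certificate hcover hθ hamo hU hT hTU
  exact ⟨_, extends_sepFormulas hT β hβ, respects_sepFormulas hβU _⟩

omit hcover in
theorem dead_of_pos_mem (S : Sep 𝒮) (p : V) (hp : p ∈ S.1) (q : V) (hq : q ∈ S.1) (hne : p ≠ q)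
    (hpU : Lit.pos (D.nodeVar' Z p) ∈ U) : q ∉ alive (D.nodeVar' Z) U := by
  intro hqU
  obtain ⟨a, ha, haU, haq⟩ := PCOn.exists_model (hθ S).2 (closed_sepLits hU S)
    (l := Lit.neg (Sum.inl ⟨q, hq⟩)) hqU
  have hap := haU (Lit.pos (Sum.inl ⟨p, hp⟩)) hpU
  have hP : P S fun v => a (Sum.inl v) := ((hθ S).1 _).2 ⟨fun z => a (Sum.inr z), by
    convert ha using 1
    exact Sum.elim_comp_inl_inr a⟩
  have := hamo S _ hP ⟨p, hp⟩ ⟨q, hq⟩ hap (by simpa [Lit.Holds, Lit.neg] using haq)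
  exact hne (congrArg Subtype.val this)

end PC

/-- A literal `v` of `S`, or a literal on an auxiliary variable, that is not propagated is false in
a model in which exactly one node of `S` is true; this node is alive. -/
theorem exists_alive_model {θ : ∀ S : Sep 𝒮, CNF (S.1 ⊕ Z S)}
    (hθ : ∀ S, IsPCEncoding ExactlyOne (θ S))
    {U : Set (Lit (DomVar (fun _ : ι => Bool) ⊕ (D.Inner ⊕ (Σ S, Z S))))}
    (hU : Closed (D.sepFormulas θ) U) {S : Sep 𝒮} {l : Lit (S.1 ⊕ Z S)}
    (hl : l ∉ D.sepLits U S) :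
    ∃ a, Sat (θ S) a ∧ (∀ g ∈ D.sepLits U S, g.Holds a) ∧ ¬ l.Holds a ∧
      ∃ q : S.1, q.1 ∈ alive (D.nodeVar' Z) U ∧ ∀ v : S.1, a (Sum.inl v) = true ↔ v = q := by
  obtain ⟨a, ha, haU, hal⟩ := PCOn.exists_model (hθ S).2 (closed_sepLits hU S) hl
  have hP : ExactlyOne fun v => a (Sum.inl v) := ((hθ S).1 _).2 ⟨fun z => a (Sum.inr z), by
    convert ha using 1
    exact Sum.elim_comp_inl_inr a⟩
  obtain ⟨q, hq, huniq⟩ := hP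
  refine ⟨a, ha, haU, hal, q, fun hqU => ?_, fun v => ⟨huniq v, fun h => h ▸ hq⟩⟩
  have := haU (Lit.neg (Sum.inl q)) hqU
  simp only [Lit.Holds, Lit.neg] at this
  exact Bool.false_ne_true (this.symm.trans hq)

variable [Finite V] [Finite ι] [∀ S, Finite (Z S)] (hdec : D.Decomposable) (hsmooth : D.Smooth)
  (hcover : D.IsSeparatorCover 𝒮) {f : (ι → Bool) → Prop} (hf : D.Represents f)
  {θ : ∀ S : Sep 𝒮, CNF (S.1 ⊕ Z S)}

include hdec hsmooth hcover hf

theorem isURCEncoding_psiPrime (hθ : ∀ S, IsPCEncoding AtMostOne (θ S)) :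
    IsURCEncoding f (boolSubst (D.psiPrime Z θ)) := by
  rw [psiPrime_eq]
  exact ⟨isEncoding_boolSubst hdec hsmooth hf (isNumbering_nodeVar' D Z) fun T hT =>
      exists_extends_sepFormulas hcover hθ (fun S p h => (exactlyOne_iff_atMostOne.1 h).1) hT,
    urcOn_boolSubst hdec hsmooth hcover (isNumbering_nodeVar' D Z)
      (fun U hU => dead_of_pos_mem hθ (fun _ _ h => h) hU)
      fun U hU T hT hTU => exists_extends_respects hcover hθ (fun _ _ h => h) hU hT hTU⟩

theorem isPCEncoding_psiPrime (hθ : ∀ S, IsPCEncoding ExactlyOne (θ S)) :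
    IsPCEncoding f (boolSubst (D.psiPrime Z θ)) := by
  classical
  have hamo : ∀ (S : Sep 𝒮) (p : S.1 → Bool), ExactlyOne p → AtMostOne p :=
    fun S p h => (exactlyOne_iff_atMostOne.1 h).1
  rw [psiPrime_eq]
  refine ⟨isEncoding_boolSubst hdec hsmooth hf (isNumbering_nodeVar' D Z) fun T hT =>
      exists_extends_sepFormulas hcover hθ (fun _ _ h => h) hT,
    pcOn_boolSubst hdec hsmooth hcover (isNumbering_nodeVar' D Z)
      (fun U hU => dead_of_pos_mem hθ hamo hU)
      (fun U hU T hT hTU => exists_extends_respects hcover hθ hamo hU hT hTU) ?_ ?_⟩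
  · intro U hU S v hv hvU
    obtain ⟨a, -, -, hal, q, hq, haq⟩ := exists_alive_model hθ hU (S := S)
      (l := Lit.pos (Sum.inl ⟨v, hv⟩)) hvU
    refine ⟨q.1, q.2, fun e => hal ?_, hq⟩
    exact (haq _).2 (Subtype.ext e.symm)
  · rintro U hU (v | ⟨S, z⟩) hz s hs
    · exact (hz ⟨v, rfl⟩).elim
    · obtain ⟨a, ha, haU, hal, q, hq, haq⟩ := exists_alive_model hθ hU (S := S)
        (l := ⟨Sum.inr z, s⟩) hs
      refine ⟨q.1, hq, fun T hT hTU hqT => ?_⟩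
      choose β hβ hβU using exists_aux_of_certificate hcover hθ hamo hU hT hTU
      -- the model `a` supplies the values on the auxiliary variables of `S`
      have hkey : ∀ S', Sat (θ S') (Sum.elim (fun v : S'.1 => decide (v.1 ∈ T))
          (Function.update β S (fun z => a (Sum.inr z)) S')) ∧
          ∀ z s, (⟨Sum.inr z, s⟩ : Lit (S'.1 ⊕ Z S')) ∈ D.sepLits U S' →
            Function.update β S (fun z => a (Sum.inr z)) S' z = s := by
        intro S'
        by_cases hS : S' = S
        · subst hS
          rw [Function.update_self]
          refine ⟨?_, fun z s hzs => haU _ hzs⟩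
          convert ha
          funext w
          rcases w with v | z
          · rw [Sum.elim_inl, Bool.eq_iff_iff, haq, decide_eq_true_iff]
            exact ⟨fun hv => Subtype.ext ((hT.existsUnique_sep hcover S').unique
              ⟨hv, v.2⟩ ⟨hqT, q.2⟩), fun hv => hv ▸ hqT⟩
          · rfl
        · rw [Function.update_of_ne hS]
          exact ⟨hβ S', hβU S'⟩
      refine ⟨_, extends_sepFormulas hT _ fun S' => (hkey S').1,
        respects_sepFormulas (fun S' => (hkey S').2) _, ?_⟩
      simp only [Sum.elim_inr, Function.update_self]
      exact hal

end Auxiliary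

end NNF

end DNNFEnc

theorem mainTheorem2 {n : ℕ} {V : Type*} [Finite V]
    (D : NNF (fun _ : Fin n => Bool) V) (hdec : D.Decomposable) (hsmooth : D.Smooth)
    (𝒮 : Fin n → Set (Finset V)) (hcover : D.IsSeparatorCover 𝒮)
    (f : (Fin n → Bool) → Prop) (hf : D.Represents f) :
    -- `φ_c` and `φ_p`
    CNF.IsURCEncoding f (boolSubst (D.psiC 𝒮)) ∧
    CNF.IsPCEncoding f (boolSubst (D.psiP 𝒮)) ∧
    -- `φ'_c` and `φ'_p` built with `μ_{|S|}` and `ε_{|S|}`, for any ordering of each separator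
    (∀ e : ∀ S : NNF.Sep 𝒮, Fin S.1.card ≃ S.1,
      CNF.IsURCEncoding f
        (boolSubst (D.psiPrime (fun S => Fin (S.1.card - 3)) fun S => NNF.muSep S.1 (e S))) ∧
      CNF.IsPCEncoding f
        (boolSubst (D.psiPrime (fun S => Fin (S.1.card - 3)) fun S => NNF.epsSep S.1 (e S)))) ∧
    -- `φ'_c` and `φ'_p` built with arbitrary admissible encodings of the two constraints
    (∀ (Z : NNF.Sep 𝒮 → Type) [∀ S, Finite (Z S)] (θ : ∀ S : NNF.Sep 𝒮, CNF (S.1 ⊕ Z S)),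
      ((∀ S, AmoAdmissible (θ S)) → CNF.IsURCEncoding f (boolSubst (D.psiPrime Z θ))) ∧
      ((∀ S, EoAdmissible (θ S)) → CNF.IsPCEncoding f (boolSubst (D.psiPrime Z θ)))) := by
  refine ⟨NNF.isURCEncoding_psiC hdec hsmooth hcover hf,
    NNF.isPCEncoding_psiP hdec hsmooth hcover hf,
    fun e => ⟨NNF.isURCEncoding_psiPrime hdec hsmooth hcover hf fun S => isPCEncoding_muSep _ _,
      NNF.isPCEncoding_psiPrime hdec hsmooth hcover hf fun S => isPCEncoding_epsSep _ _⟩,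
    fun Z _ θ => ⟨fun hθ => NNF.isURCEncoding_psiPrime hdec hsmooth hcover hf fun S => (hθ S).1,
      fun hθ => NNF.isPCEncoding_psiPrime hdec hsmooth hcover hf fun S => (hθ S).1⟩⟩
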